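/- **Setting.** A network $\mathcal G$ has a finite set $\mathcal C$ of nodes and a finite set of arrows, an equivalence relation "same type" on nodes and one on arrows, and for each arrow $a$ a head node $\mathcal H(a)$ and a tail node $\mathcal T(a)$. Put $I(c)=\{a:\mathcal H(a)=c\}$. For nodes $c,d$, $B(c,d)$ is the set of arrow-type preserving bijections $I(c)\to I(d)$ if $c,d$ have the same node-type, and $B(c,d)=\emptyset$ otherwise; elements of $B(d,d)$ are called vertex symmetries. State equivalence $\sim_S$ is the equivalence relation on $\mathcal C$ generated by $c\sim_S d$ and $\mathcal T(a)\sim_S\mathcal T(\beta(a))$ for all $\beta\in B(c,d)$, $a\in I(c)$. Node spaces are $P_c=\mathbb R^{k_c}$ with $k_c\ge 1$, with $P_c=P_d$ if $c\sim_S d$; $P=\prod_c P_c$ with norm $\|x\|=\max_c\|x_c\|_{\mathrm{Eucl}}$. Write $x_{T(c)}=(x_{\mathcal T(a)})_{a\in I(c)}\in P_{T(c)}$ and $x_{I(c)}=(x_c,x_{T(c)})$; for $\beta\in B(c,d)$ the pullback $\beta^*$ maps $(v_b)_{b\in I(d)}$ to $(v_{\beta(a)})_{a\in I(c)}$, and $\beta^*x_{I(d)}=(x_d,\beta^*x_{T(d)})$.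 A map $f:P\to P$ is admissible if there are functions $\hat f_c:P_c\times P_{T(c)}\to P_c$ with $f_c(x)=\hat f_c(x_c,x_{T(c)})$ and $\hat f_d(u,v)=\hat f_c(u,\beta^*v)$ for all $\beta\in B(c,d)$. For $C^1$ maps $p:P\to P$ let $\|p\|_1=\sup_x\max(\|p(x)\|,\|\mathrm Dp(x)\|)$. A perturbation is a $C^\infty$ admissible map $p$; statements "for all small $p$" mean: there is $\varepsilon>0$ such that they hold for all perturbations $p$ with $\|p\|_1<\varepsilon$. A periodic orbit of an ODE is a nonconstant solution $x:\mathbb R\to P$ with $x(t+T)\equiv x(t)$ for some $T>0$ (called its period; it need not be minimal). It is hyperbolic if, counted with algebraic multiplicity, exactly one of its Floquet multipliers over $[0,T]$ lies on the unit circle (namely the multiplier $1$). If $x$ is a hyperbolic periodic orbit of $\dot x=f(x)$ with $f$ smooth, then for small $p$ the perturbed orbit $\tilde x$ is the periodic orbit of $\dot x=f(x)+p(x)$ near $x$ with period $\tilde T$ near $T$, which is unique up to a time shift; the shift is fixed, where it matters, by $\tilde x(t_0)\in\Sigma$, where $\Sigma$ is a hyperplane through $x(t_0)$ transverse to $\dot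 x(t_0)$. A colouring is an equivalence relation $\bowtie$ on $\mathcal C$ such that $c\bowtie d$ implies $c\sim_S d$; $\Delta_{\bowtie}=\{x\in P: c\bowtie d\Rightarrow x_c=x_d\}$. It is a rigid synchrony pattern of $x$ if $\tilde x(t)\in\Delta_{\bowtie}$ for all $t$ and all small $p$. Given a set $\mathcal R$ of representatives for $\bowtie$, with $[c]\in\mathcal R$ the representative of $c$, and $g=f+p$, the induced ODE is $\dot u_r=\hat g_r(u_r,(u_{[\mathcal T(a)]})_{a\in I(r)})$, $r\in\mathcal R$, and the induced orbit is $\tilde x^{\mathcal R}=(\tilde x_r)_{r\in\mathcal R}$. The orbit $x$ is strongly hyperbolic if it is hyperbolic and, for every colouring $\bowtie$ that is a rigid synchrony pattern of $x$, there is $\mathcal R$ such that for arbitrarily small perturbations $p$ (possibly $p=0$) the induced orbit $\tilde x^{\mathcal R}$ is a hyperbolic periodic orbit of the induced ODE. **Theorem (Local Rigid Phase Property).** Let $f:P\to P$ be smooth and admissible, and let $x$ be a strongly hyperbolic periodic orbit of $\dot x=f(x)$ with period $T$. Let $t_0\in\mathbb R$ and a section $\Sigma$ as above be given. Let $c,d$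 be nodes (possibly equal), $\theta\in\mathbb R/\mathbb Z$, and $J\subseteq\mathbb R$ an interval with non-empty interior. Suppose that $c,d$ are rigidly phase-related on $J$ by the fixed proportion $\theta$ of the period: for all small perturbations $p$, $$\tilde x_c(t)=\tilde x_d(t+\theta\tilde T)\qquad\text{for all } t\in J .$$ Then $B(c,d)\neq\emptyset$, and, for any choice of $\tau\in B(c,d)$ used to identify $I(c)$ with $I(d)$, there is a vertex symmetry $\beta\in B(d,d)$ such that $$x_{I(c)}(t)=\tau^*\beta^*x_{I(d)}(t+\theta T)\qquad\text{for all } t\in J .$$ -/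

import Mathlib

open scoped ContDiff ENNReal

/-- A network: nodes `C`, arrows `A`, each with a type (given by the equivalence relation
"same type"), and a head and a tail node for each arrow. -/
structure Network (C A : Type*) where
  nodeType : Setoid C
  arrowType : Setoid A
  head : A → C
  tail : A → C

namespace Network

variable {C A : Type*}

/-- The input set `I(c)`: all arrows with head `c`. -/
abbrev Input (G : Network C A) (c : C) : Type _ := {a : A // G.head a = c}

/-- `B(c,d)`: the input isomorphisms from `c` to `d`, that is, the arrow-type preserving
bijections `I(c) → I(d)`, where `c` and `d` have the same node-type. For `c = d` these are the
vertex symmetries. -/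
structure InputIso (G : Network C A) (c d : C) where
  toEquiv : G.Input c ≃ G.Input d
  node_rel : G.nodeType c d
  arrow_rel : ∀ a : G.Input c, G.arrowType a.1 (toEquiv a).1

/-- The equalities between node spaces that are forced by a single input isomorphism. -/
inductive StateStep (G : Network C A) : C → C → Prop
  | node {c d : C} (β : G.InputIso c d) : StateStep G c d
  | tail {c d : C} (β : G.InputIso c d) (a : G.Input c) :
      StateStep G (G.tail a.1) (G.tail (β.toEquiv a).1)

/-- State equivalence of nodes: the equivalence relation generated by `StateStep`. -/
def StateEquiv (G : Network C A) : C → C → Prop := Relation.EqvGen G.StateStep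

/-- A choice of node spaces `P_c = ℝ^{dim c}`, nonzero, such that state-equivalent nodes have the
same node space. -/
structure NodeSpaces (G : Network C A) where
  dim : C → ℕ
  dim_pos : ∀ c, 0 < dim c
  dim_eq : ∀ {c d}, G.StateEquiv c d → dim c = dim d

end Network

/-- The identification of `ℝ^m` with `ℝ^n` when `m = n`. -/
def transport {m n : ℕ} (h : m = n) (u : EuclideanSpace ℝ (Fin m)) : EuclideanSpace ℝ (Fin n) :=
  WithLp.toLp 2 fun j => u (Fin.cast h.symm j)

/-- The `C¹` norm `sup_x max(‖p x‖, ‖Dp x‖)`, infinite if `p` is not `C¹`-bounded. -/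
noncomputable def c1Norm {E : Type*} [NormedAddCommGroup E] [NormedSpace ℝ E] (p : E → E) : ℝ≥0∞ :=
  ⨆ x, max ‖p x‖ₑ ‖fderiv ℝ p x‖ₑ

/-- `x` is a nonconstant periodic solution of `ẋ = f(x)`, and `T > 0` is a period of it. -/
structure IsPeriodicOrbit {E : Type*} [NormedAddCommGroup E] [NormedSpace ℝ E]
    (f : E → E) (x : ℝ → E) (T : ℝ) : Prop where
  period_pos : 0 < T
  solution : ∀ t, HasDerivAt x (f (x t)) t
  periodic : ∀ t, x (t + T) = x t
  nonconstant : ∃ t s, x t ≠ x s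

/-- `x` is a hyperbolic periodic orbit of `ẋ = f(x)`: with `Φ` the fundamental solution of the
variational equation along `x`, the Floquet multipliers (the complex eigenvalues of `Φ T`, counted
with algebraic multiplicity) lie off the unit circle, except for a simple one equal to `1`. -/
def IsHyperbolicOrbit {E : Type*} [NormedAddCommGroup E] [NormedSpace ℝ E] [FiniteDimensional ℝ E]
    (f : E → E) (x : ℝ → E) (T : ℝ) : Prop :=
  IsPeriodicOrbit f x T ∧
  ∃ Φ : ℝ → E →L[ℝ] E,
    Φ 0 = ContinuousLinearMap.id ℝ E ∧
    (∀ t, HasDerivAt Φ ((fderiv ℝ f (x t)).comp (Φ t)) t) ∧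
    (((Φ T : E →ₗ[ℝ] E).charpoly.map (algebraMap ℝ ℂ)).rootMultiplicity 1 = 1 ∧
      ∀ μ : ℂ, ((Φ T : E →ₗ[ℝ] E).charpoly.map (algebraMap ℝ ℂ)).IsRoot μ → ‖μ‖ = 1 → μ = 1)

/-- `y`, with period `S`, is `η`-close to `x`, with period `T`. -/
def OrbitClose {E : Type*} [NormedAddCommGroup E] (η : ℝ) (x : ℝ → E) (T : ℝ)
    (y : ℝ → E) (S : ℝ) : Prop :=
  |S - T| < η ∧ ∀ t ∈ Set.Icc 0 T, ‖y t - x t‖ < η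

/-- A set of representatives for a colouring `r` of the nodes. -/
structure Representatives {C : Type*} (r : Setoid C) where
  reps : Finset C
  bracket : C → reps
  bracket_rel : ∀ c, r (bracket c) c
  bracket_unique : ∀ (c : C) (s : reps), r s c → s = bracket c

namespace Network.NodeSpaces

variable {C A : Type*} {G : Network C A}

/-- The node space of `c`. -/
abbrev P (D : G.NodeSpaces) (c : C) : Type := EuclideanSpace ℝ (Fin (D.dim c))

/-- The state space: the product of the node spaces. Its norm (for finitely many nodes) is the
maximum of the Euclidean norms of the components. -/
abbrev State (D : G.NodeSpaces) : Type _ := (c : C) → D.P c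

theorem dim_node (D : G.NodeSpaces) {c d : C} (β : G.InputIso c d) : D.dim c = D.dim d :=
  D.dim_eq (.rel _ _ (.node β))

theorem dim_tail (D : G.NodeSpaces) {c d : C} (β : G.InputIso c d) (a : G.Input c) :
    D.dim (G.tail a.1) = D.dim (G.tail (β.toEquiv a).1) :=
  D.dim_eq (.rel _ _ (.tail β a))

/-- The pullback map `β* : P_{T(d)} → P_{T(c)}` of `β ∈ B(c,d)`, permuting coordinates. -/
def pullback (D : G.NodeSpaces) {c d : C} (β : G.InputIso c d)
    (v : (a : G.Input d) → D.P (G.tail a.1)) : (a : G.Input c) → D.P (G.tail a.1) :=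
  fun a => transport (D.dim_tail β a).symm (v (β.toEquiv a))

/-- `f` is admissible: each component has the form `f_c(x) = g_c(x_c, x_{T(c)})` (domain
condition), where `g_d(u, v) = g_c(u, β* v)` for every input isomorphism `β ∈ B(c,d)`
(pullback condition). -/
def IsAdmissible (D : G.NodeSpaces) (f : D.State → D.State) : Prop :=
  ∃ g : (c : C) → D.P c → ((a : G.Input c) → D.P (G.tail a.1)) → D.P c,
    (∀ x c, f x c = g c (x c) fun a => x (G.tail a.1)) ∧
    ∀ (c d : C) (β : G.InputIso c d) (u : D.P d) (v : (a : G.Input d) → D.P (G.tail a.1)),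
      g d u v = transport (D.dim_node β) (g c (transport (D.dim_node β).symm u) (D.pullback β v))

/-- `x_c = y_d`, for states `x` and `y` and nodes `c` and `d` with the same node space. -/
def SameState (D : G.NodeSpaces) (x y : D.State) (c d : C) : Prop :=
  ∃ h : D.dim c = D.dim d, transport h (x c) = y d

/-- The polydiagonal (synchrony space) of a colouring. -/
def polydiagonal (D : G.NodeSpaces) (r : Setoid C) : Set D.State :=
  {x | ∀ c d, r c d → D.SameState x x c d}

/-- The state space of the quasi-quotient by a set of representatives. -/
abbrev QState (D : G.NodeSpaces) {r : Setoid C} (R : Representatives r) : Type _ :=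
  (s : R.reps) → D.P s

/-- The point of the state space with components `x_c = u_{[c]}`. -/
def lift (D : G.NodeSpaces) {r : Setoid C} (hr : ∀ c d, r c d → G.StateEquiv c d)
    (R : Representatives r) (u : D.QState R) : D.State :=
  fun c => transport (D.dim_eq (hr _ _ (R.bracket_rel c))) (u (R.bracket c))

/-- The vector field of the induced ODE `u̇_s = f_s(u_s, u_{[T(s)]})`, `s ∈ R`. -/
def induced (D : G.NodeSpaces) {r : Setoid C} (hr : ∀ c d, r c d → G.StateEquiv c d)
    (R : Representatives r) (f : D.State → D.State) : D.QState R → D.QState R :=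
  fun u s => f (D.lift hr R u) s

/-- The induced orbit: the components of `x` at the representatives. -/
def restrict (D : G.NodeSpaces) {r : Setoid C} (R : Representatives r) (x : ℝ → D.State) :
    ℝ → D.QState R :=
  fun t s => x t s

variable [Fintype C]

/-- `p` is a smooth admissible perturbation with `‖p‖₁ < ε`. -/
structure IsPerturbation (D : G.NodeSpaces) (p : D.State → D.State) (ε : ℝ) : Prop where
  admissible : D.IsAdmissible p
  smooth : ContDiff ℝ ∞ p
  small : c1Norm p < ENNReal.ofReal ε

/-- The property `Q` of a periodic orbit and its period is rigid for the orbit `x` of `f` with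
period `T`: for all sufficiently small admissible perturbations `p`, the property `Q` holds for the
perturbed periodic orbit, that is, for the periodic solutions of `ẏ = f(y) + p(y)` close to `x`
with period close to `T` (when `x` is hyperbolic, there is just one, up to a shift of time). -/
def IsRigid (D : G.NodeSpaces) (f : D.State → D.State) (x : ℝ → D.State) (T : ℝ)
    (Q : (ℝ → D.State) → ℝ → Prop) : Prop :=
  ∃ η > 0, ∃ ε > 0, ∀ p, D.IsPerturbation p ε →
    ∀ y S, IsPeriodicOrbit (f + p) y S → OrbitClose η x T y S → Q y S

/-- `x` is strongly hyperbolic: it is hyperbolic and, for every colouring that it has as a rigid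
synchrony pattern (so that perturbed orbits do induce orbits on the quasi-quotients), there is a
set of representatives such that, after an arbitrarily small perturbation, the induced orbit is a
hyperbolic periodic orbit of the induced ODE. Nodes of the same colour are state equivalent. -/
structure IsStronglyHyperbolic (D : G.NodeSpaces) (f : D.State → D.State) (x : ℝ → D.State)
    (T : ℝ) : Prop where
  hyperbolic : IsHyperbolicOrbit f x T
  induced : ∀ (r : Setoid C) (hr : ∀ c d, r c d → G.StateEquiv c d),
    D.IsRigid f x T (fun y _ => ∀ t, y t ∈ D.polydiagonal r) →
    ∃ R : Representatives r, ∀ ε > 0, ∃ p, D.IsPerturbation p ε ∧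
      ∃ y S, IsPeriodicOrbit (f + p) y S ∧ OrbitClose ε x T y S ∧
        IsHyperbolicOrbit (D.induced hr R (f + p)) (D.restrict R y) S

/-- Nodes `c` and `d` are rigidly phase-related on `J` by the proportion `θ` of the period:
`y_c(t) = y_d(t + θ S)` for all `t ∈ J`, for the perturbed periodic orbits `y`, of period `S`.
Their initial conditions are fixed by the Poincaré section `{z | ℓ z = ℓ (x t₀)}` through `x t₀`.
Only the class of `θ` in `ℝ/ℤ` matters. -/
def RigidlyPhaseRelated (D : G.NodeSpaces) (f : D.State → D.State) (x : ℝ → D.State) (T : ℝ)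
    (t₀ : ℝ) (ℓ : D.State →L[ℝ] ℝ) (c d : C) (θ : ℝ) (J : Set ℝ) : Prop :=
  D.IsRigid f x T fun y S =>
    ℓ (y t₀) = ℓ (x t₀) → ∀ t ∈ J, D.SameState (y t) (y (t + θ * S)) c d

end Network.NodeSpaces

open scoped ContDiff ENNReal unitInterval Topology
open Set Filter MeasureTheory

section Superposition
variable {X E F : Type*} [TopologicalSpace X] [CompactSpace X]
  [NormedAddCommGroup E] [NormedSpace ℝ E] [NormedAddCommGroup F] [NormedSpace ℝ F]

/-- Pointwise application of a continuous family of operators to a continuous function. -/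
noncomputable def ContinuousMap.applyL :
    C(X, E →L[ℝ] F) →L[ℝ] C(X, E) →L[ℝ] C(X, F) :=
  LinearMap.mkContinuous₂
    (LinearMap.mk₂ ℝ
      (fun (A : C(X, E →L[ℝ] F)) (h : C(X, E)) =>
        (⟨fun t => A t (h t), by fun_prop⟩ : C(X, F)))
      (fun _ _ _ => by ext; simp) (fun _ _ _ => by ext; simp)
      (fun _ _ _ => by ext; simp) (fun _ _ _ => by ext; simp)) 1
    fun A h => by
      rw [ContinuousMap.norm_le _ (by positivity)]
      intro t
      rw [one_mul]
      exact ((A t).le_opNorm (h t)).trans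
        (mul_le_mul (A.norm_coe_le_norm t) (h.norm_coe_le_norm t) (norm_nonneg _)
          ((norm_nonneg _).trans (A.norm_coe_le_norm t)))

theorem ContinuousMap.hasFDerivAt_comp (G : C(E, F)) (dG : C(E, E →L[ℝ] F))
    (hG : ∀ u, HasFDerivAt G (dG u) u) (ξ : C(X, E)) :
    HasFDerivAt (fun η : C(X, E) => G.comp η) (ContinuousMap.applyL (dG.comp ξ)) ξ := by
  rw [hasFDerivAt_iff_isLittleO, Asymptotics.isLittleO_iff]
  intro c hc
  have hcont : Continuous fun η : C(X, E) => dG.comp η := ContinuousMap.continuous_postcomp dG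
  obtain ⟨δ, hδ, hball⟩ :=
    (Metric.continuous_iff (α := C(X, E)) (β := C(X, E →L[ℝ] F))).1 hcont ξ c hc
  filter_upwards [Metric.ball_mem_nhds ξ hδ] with η hη
  rw [ContinuousMap.norm_le _ (by positivity)]
  intro t
  have hseg : ∀ z ∈ segment ℝ (ξ t) (η t), ‖dG z - dG (ξ t)‖ ≤ c := by
    intro z hz
    rw [segment_eq_image'] at hz
    obtain ⟨s, hs, rfl⟩ := hz
    have h1 : dist (ξ + s • (η - ξ)) ξ < δ := by
      rw [dist_eq_norm, add_sub_cancel_left, norm_smul, Real.norm_eq_abs, abs_of_nonneg hs.1]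
      rw [Metric.mem_ball, dist_eq_norm] at hη
      exact (mul_le_of_le_one_left (norm_nonneg _) hs.2).trans_lt hη
    have h2 := hball _ h1
    rw [← dist_eq_norm]
    exact (ContinuousMap.dist_apply_le_dist (f := dG.comp (ξ + s • (η - ξ)))
      (g := dG.comp ξ) t).trans h2.le
  have := (convex_segment (ξ t) (η t)).norm_image_sub_le_of_norm_hasFDerivWithin_le'
    (fun z _ => (hG z).hasFDerivWithinAt) hseg (left_mem_segment ℝ _ _) (right_mem_segment ℝ _ _)
  refine (this.trans ?_)
  exact mul_le_mul_of_nonneg_left ((η - ξ).norm_coe_le_norm t) hc.le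

theorem ContinuousMap.contDiff_comp (G : C(E, F)) (hG : ContDiff ℝ 1 G) :
    ContDiff ℝ 1 (fun η : C(X, E) => G.comp η) := by
  let dG : C(E, E →L[ℝ] F) := ⟨fderiv ℝ G, hG.continuous_fderiv one_ne_zero⟩
  rw [contDiff_one_iff_hasFDerivAt]
  refine ⟨fun ξ => ContinuousMap.applyL (dG.comp ξ), ?_, fun ξ => G.hasFDerivAt_comp dG
    (fun u => (hG.differentiable one_ne_zero u).hasFDerivAt) ξ⟩
  exact ContinuousMap.applyL.continuous.comp (ContinuousMap.continuous_postcomp dG)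

end Superposition

section Volterra
variable {E : Type*} [NormedAddCommGroup E] [NormedSpace ℝ E]

omit [NormedSpace ℝ E] in
theorem ContinuousMap.continuous_IccExtend_unit (h : C(I, E)) :
    Continuous (Set.IccExtend (zero_le_one' ℝ) h) :=
  h.continuous.Icc_extend'

/-- The operator `h ↦ ∫₀^τ h`. -/
noncomputable def ContinuousMap.volterra : C(I, E) →L[ℝ] C(I, E) :=
  LinearMap.mkContinuous
    { toFun := fun h => ⟨fun τ => ∫ s in (0:ℝ)..τ, Set.IccExtend (zero_le_one' ℝ) h s, by
        have := intervalIntegral.continuous_primitive (μ := volume)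
          (fun a b => h.continuous_IccExtend_unit.intervalIntegrable a b) 0
        exact this.comp continuous_subtype_val⟩
      map_add' := fun h k => by
        ext τ
        simp only [ContinuousMap.coe_mk, ContinuousMap.add_apply]
        rw [← intervalIntegral.integral_add (h.continuous_IccExtend_unit.intervalIntegrable _ _)
          (k.continuous_IccExtend_unit.intervalIntegrable _ _)]
        rfl
      map_smul' := fun c h => by
        ext τ
        simp only [ContinuousMap.coe_mk, ContinuousMap.smul_apply, RingHom.id_apply]
        rw [← intervalIntegral.integral_smul]
        rfl } 1
    fun h => by
      rw [ContinuousMap.norm_le _ (by positivity)]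
      intro τ
      have := intervalIntegral.norm_integral_le_of_norm_le_const (a := (0:ℝ)) (b := (τ:ℝ))
        (f := Set.IccExtend (zero_le_one' ℝ) h) (C := ‖h‖) (fun s _ => h.norm_coe_le_norm _)
      refine this.trans ?_
      rw [one_mul, sub_zero, abs_of_nonneg τ.2.1]
      exact mul_le_of_le_one_right (norm_nonneg _) τ.2.2

theorem ContinuousMap.volterra_apply (h : C(I, E)) (τ : I) :
    ContinuousMap.volterra h τ = ∫ s in (0:ℝ)..τ, Set.IccExtend (zero_le_one' ℝ) h s := rfl

theorem ContinuousMap.norm_volterra_le (h : C(I, E)) :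
    ‖ContinuousMap.volterra h‖ ≤ ∫ s in (0:ℝ)..1, ‖Set.IccExtend (zero_le_one' ℝ) h s‖ := by
  have hc := h.continuous_IccExtend_unit.norm
  rw [ContinuousMap.norm_le _
    (intervalIntegral.integral_nonneg zero_le_one fun _ _ => norm_nonneg _)]
  intro τ
  refine (intervalIntegral.norm_integral_le_integral_norm τ.2.1).trans ?_
  exact intervalIntegral.integral_mono_interval le_rfl τ.2.1 τ.2.2
    (Eventually.of_forall fun _ => norm_nonneg _) (hc.intervalIntegrable _ _)

end Volterra

section PeriodMap
variable {E : Type*} [NormedAddCommGroup E] [NormedSpace ℝ E]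

/-- The periodic extension of a function on the unit interval. -/
noncomputable def profile (ξ : C(I, E)) (τ : ℝ) : E :=
  ξ ⟨Int.fract τ, Int.fract_nonneg τ, (Int.fract_lt_one τ).le⟩

omit [NormedSpace ℝ E] in
theorem profile_periodic (ξ : C(I, E)) : Function.Periodic (profile ξ) 1 := by
  intro τ
  simp [profile]

omit [NormedSpace ℝ E] in
theorem norm_profile_sub_le (ξ η : C(I, E)) (τ : ℝ) : ‖profile ξ τ - profile η τ‖ ≤ ‖ξ - η‖ :=
  (ξ - η).norm_coe_le_norm _

/-- The zeros `(ξ, S)` of this map are the `1`-periodic functions `ξ` solving `ξ' = S • g(ξ)` with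
`ℓ (ξ 0) = c`. -/
noncomputable def periodMap (ℓ : E →L[ℝ] ℝ) (c : ℝ) (G : C(E, E)) (u : C(I, E) × ℝ) : C(I, E) × ℝ :=
  (u.1 - ContinuousMap.const I (u.1 1) - u.2 • ContinuousMap.volterra (G.comp u.1), ℓ (u.1 0) - c)

/-- A nondegenerate zero of the period map. -/
structure IsNondegenerateZero (ℓ : E →L[ℝ] ℝ) (c : ℝ) (G : C(E, E)) (u : C(I, E) × ℝ) : Prop where
  zero : periodMap ℓ c G u = 0
  invertible : (fderiv ℝ (periodMap ℓ c G) u).IsInvertible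

variable {ℓ : E →L[ℝ] ℝ} {c : ℝ} {G Q : C(E, E)}

/-- Evaluation followed by the inclusion of the constants. -/
noncomputable def ContinuousMap.constEval (t : I) : C(I, E) →L[ℝ] C(I, E) :=
  LinearMap.mkContinuous
    { toFun := fun ξ => ContinuousMap.const I (ξ t)
      map_add' := fun _ _ => rfl
      map_smul' := fun _ _ => rfl } 1
    fun ξ => by
      rw [ContinuousMap.norm_le _ (by positivity), one_mul]
      exact fun _ => ξ.norm_coe_le_norm t

theorem contDiff_periodMap_family (hG : ContDiff ℝ 1 G) (hQ : ContDiff ℝ 1 Q) :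
    ContDiff ℝ 1 fun v : ℝ × (C(I, E) × ℝ) => periodMap ℓ c (G + v.1 • Q) v.2 := by
  have e : (fun v : ℝ × (C(I, E) × ℝ) => periodMap ℓ c (G + v.1 • Q) v.2) = fun v =>
      (v.2.1 - ContinuousMap.constEval 1 v.2.1 - v.2.2 • ContinuousMap.volterra
        (G.comp v.2.1 + v.1 • Q.comp v.2.1),
        ℓ (ContinuousMap.evalCLM ℝ (0 : I) v.2.1) - c) := rfl
  rw [e]
  have h1 := (ContinuousMap.contDiff_comp (X := I) G hG)
  have h2 := (ContinuousMap.contDiff_comp (X := I) Q hQ)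
  have h1' : ContDiff ℝ 1 fun v : ℝ × (C(I, E) × ℝ) => G.comp v.2.1 :=
    h1.comp (contDiff_fst.comp contDiff_snd)
  have h2' : ContDiff ℝ 1 fun v : ℝ × (C(I, E) × ℝ) => Q.comp v.2.1 :=
    h2.comp (contDiff_fst.comp contDiff_snd)
  fun_prop

theorem fderiv_periodMap (hG : ContDiff ℝ 1 G) (u : C(I, E) × ℝ) (w : C(I, E) × ℝ) :
    fderiv ℝ (periodMap ℓ c G) u w =
      (w.1 - ContinuousMap.const I (w.1 1) - u.2 • ContinuousMap.volterra
        (ContinuousMap.applyL ((⟨fderiv ℝ G, hG.continuous_fderiv one_ne_zero⟩ :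
          C(E, E →L[ℝ] E)).comp u.1) w.1) - w.2 • ContinuousMap.volterra (G.comp u.1),
        ℓ (w.1 0)) := by
  let dG : C(E, E →L[ℝ] E) := ⟨fderiv ℝ G, hG.continuous_fderiv one_ne_zero⟩
  have hc : HasFDerivAt (fun η : C(I, E) × ℝ => G.comp η.1) _ u :=
    (G.hasFDerivAt_comp dG (fun z => (hG.differentiable one_ne_zero z).hasFDerivAt) u.1).comp u
      hasFDerivAt_fst
  have h1 : HasFDerivAt (fun η : C(I, E) × ℝ => η.2 • ContinuousMap.volterra (G.comp η.1)) _ u :=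
    hasFDerivAt_snd.smul ((ContinuousMap.volterra (E := E)).hasFDerivAt.comp u hc)
  have h2 : HasFDerivAt (fun η : C(I, E) × ℝ => η.1 - ContinuousMap.constEval 1 η.1) _ u :=
    hasFDerivAt_fst.sub ((ContinuousMap.constEval (E := E) 1).hasFDerivAt.comp u hasFDerivAt_fst)
  have h3 : HasFDerivAt (fun η : C(I, E) × ℝ => ℓ (ContinuousMap.evalCLM ℝ (0 : I) η.1) - c) _ u :=
    (ℓ.comp ((ContinuousMap.evalCLM ℝ (0 : I)).comp
      (ContinuousLinearMap.fst ℝ C(I, E) ℝ))).hasFDerivAt.sub_const c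
  have h : HasFDerivAt (periodMap ℓ c G) _ u := (h2.sub h1).prodMk h3
  rw [h.fderiv, ContinuousLinearMap.prod_apply]
  refine congrArg₂ Prod.mk ?_ rfl
  rw [sub_sub (_ - _)]
  rfl

omit [NormedSpace ℝ E] in
theorem profile_eq_IccExtend {ξ : C(I, E)} (h : ξ 0 = ξ 1) {s : ℝ} (hs : s ∈ Icc (0:ℝ) 1) :
    profile ξ s = IccExtend (zero_le_one' ℝ) ξ s := by
  rw [IccExtend_of_mem _ _ hs]
  rcases eq_or_lt_of_le hs.2 with rfl | h1
  · have : profile ξ 1 = ξ 0 := by simp [profile]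
    rw [this, h]; rfl
  · simp [profile, Int.fract_eq_self.2 ⟨hs.1, h1⟩]

theorem periodMap_eq_zero_iff {u : C(I, E) × ℝ} :
    periodMap ℓ c G u = 0 ↔
      (∀ t, u.1 t = u.1 1 + u.2 • ContinuousMap.volterra (G.comp u.1) t) ∧ ℓ (u.1 0) = c := by
  rw [periodMap, Prod.mk_eq_zero, sub_eq_zero (b := c)]
  refine and_congr_left' ⟨fun h t => ?_, fun h => ?_⟩
  · have := congrArg (fun f : C(I, E) => f t) h
    simp only [ContinuousMap.sub_apply, ContinuousMap.smul_apply, ContinuousMap.const_apply,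
      ContinuousMap.zero_apply] at this
    rw [← sub_eq_zero, ← this]; abel
  · ext t
    simp only [ContinuousMap.sub_apply, ContinuousMap.smul_apply, ContinuousMap.const_apply,
      ContinuousMap.zero_apply]
    rw [h t]; abel

theorem apply_zero_eq_apply_one {u : C(I, E) × ℝ} (h : periodMap ℓ c G u = 0) :
    u.1 0 = u.1 1 := by
  have := (periodMap_eq_zero_iff.1 h).1 0
  simpa [ContinuousMap.volterra_apply] using this

theorem hasDerivAt_profile [CompleteSpace E] {u : C(I, E) × ℝ} (h : periodMap ℓ c G u = 0)
    (τ : ℝ) : HasDerivAt (profile u.1) (u.2 • G (profile u.1 τ)) τ := by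
  have h01 := apply_zero_eq_apply_one h
  have hV := (periodMap_eq_zero_iff.1 h).1
  have hcont : Continuous (profile u.1) := by
    have h1 : ContinuousOn (IccExtend (zero_le_one' ℝ) u.1) (Icc (0:ℝ) 1) :=
      u.1.continuous_IccExtend_unit.continuousOn
    have h2 := h1.comp_fract'' (by simpa using h01)
    convert h2 using 1
    ext s
    rw [Function.comp, IccExtend_of_mem _ _ ⟨Int.fract_nonneg s, (Int.fract_lt_one s).le⟩]
    rfl
  have hGc : Continuous fun s => G (profile u.1 s) := by fun_prop
  have hint : ∀ t : I, ContinuousMap.volterra (G.comp u.1) t =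
      ∫ s in (0:ℝ)..t, G (profile u.1 s) := by
    intro t
    rw [ContinuousMap.volterra_apply]
    refine intervalIntegral.integral_congr fun s hs => ?_
    rw [uIcc_of_le t.2.1] at hs
    have hs' : s ∈ Icc (0:ℝ) 1 := ⟨hs.1, hs.2.trans t.2.2⟩
    exact (congrArg G (profile_eq_IccExtend h01 hs')).symm
  let z : ℝ → E := fun τ => u.1 1 + u.2 • ∫ s in (0:ℝ)..τ, G (profile u.1 s)
  have hz : ∀ τ, HasDerivAt z (u.2 • G (profile u.1 τ)) τ := fun τ =>
    ((intervalIntegral.integral_hasDerivAt_right (hGc.intervalIntegrable _ _)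
      (hGc.stronglyMeasurableAtFilter _ _) hGc.continuousAt).const_smul u.2).const_add _
  have hone : u.2 • ∫ s in (0:ℝ)..1, G (profile u.1 s) = 0 := by
    have h1 := hV 1
    rw [hint] at h1
    simpa using h1
  have hper : Function.Periodic (fun s => G (profile u.1 s)) 1 := fun s => by
    simp only [profile_periodic u.1 s]
  have hzper : Function.Periodic z 1 := by
    intro τ
    have : ∫ s in (0:ℝ)..(τ + 1), G (profile u.1 s) =
        (∫ s in (0:ℝ)..τ, G (profile u.1 s)) + ∫ s in (0:ℝ)..1, G (profile u.1 s) := by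
      rw [← intervalIntegral.integral_add_adjacent_intervals (hGc.intervalIntegrable 0 τ)
        (hGc.intervalIntegrable τ (τ+1)), hper.intervalIntegral_add_eq τ 0, zero_add]
    simp only [z, this, smul_add, hone, add_zero]
  have heq : profile u.1 = z := by
    ext s
    have e1 : z s = z (Int.fract s) := by
      conv_lhs => rw [← Int.floor_add_fract s, add_comm]
      have := hzper.int_mul ⌊s⌋ (Int.fract s)
      simpa using this
    rw [e1]
    have := hV ⟨Int.fract s, Int.fract_nonneg s, (Int.fract_lt_one s).le⟩
    rw [hint] at this
    exact this
  have := hz τ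
  rw [← heq] at this
  exact this

theorem IsNondegenerateZero.exists_family [CompleteSpace E] (hG : ContDiff ℝ 1 G)
    {u : C(I, E) × ℝ} (hu : IsNondegenerateZero ℓ c G u) :
    ∃ K : ℝ, ∀ Q : C(E, E), ContDiff ℝ 1 Q → ∃ φ : ℝ → C(I, E) × ℝ, ∃ v : C(I, E) × ℝ,
      φ 0 = u ∧ (∀ᶠ ε in 𝓝 0, IsNondegenerateZero ℓ c (G + ε • Q) (φ ε)) ∧ HasDerivAt φ v 0 ∧
      ‖v‖ ≤ K * ∫ s in (0:ℝ)..1, ‖Q (profile u.1 s)‖ := by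
  refine ⟨‖(fderiv ℝ (periodMap ℓ c G) u).inverse‖ * |u.2|, fun Q hQ => ?_⟩
  set F : ℝ × (C(I, E) × ℝ) → C(I, E) × ℝ := fun v => periodMap ℓ c (G + v.1 • Q) v.2 with hF
  have hFc : ContDiff ℝ 1 F := contDiff_periodMap_family hG hQ
  have hpart : ∀ (ε : ℝ) (w : C(I, E) × ℝ), fderiv ℝ (periodMap ℓ c (G + ε • Q)) w =
      (fderiv ℝ F (ε, w)) ∘L .inr ℝ ℝ (C(I, E) × ℝ) := by
    intro ε w
    have h1 : HasFDerivAt (fun w : C(I, E) × ℝ => ((ε, w) : ℝ × (C(I, E) × ℝ)))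
      (.inr ℝ ℝ (C(I, E) × ℝ)) w := hasFDerivAt_prodMk_right ε w
    exact ((hFc.differentiable one_ne_zero (ε, w)).hasFDerivAt.comp w h1).fderiv
  have h0 : G + (0:ℝ) • Q = G := by simp
  have hinv : ((fderiv ℝ F (0, u)) ∘L .inr ℝ ℝ (C(I, E) × ℝ)).IsInvertible := by
    rw [← hpart, h0]; exact hu.invertible
  have hFa : ContDiffAt ℝ 1 F (0, u) := hFc.contDiffAt
  set φ := hFa.implicitFunction one_ne_zero hinv with hφ
  have hφ0 : φ 0 = u := hFa.implicitFunction_apply_self one_ne_zero hinv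
  have hd := (hFa.hasStrictFDerivAt_implicitFunction one_ne_zero hinv).hasFDerivAt.hasDerivAt
  have hcontφ : ContinuousAt φ 0 := hd.continuousAt
  refine ⟨φ, _, hφ0, ?_, hd, ?_⟩
  · have hz := hFa.eventually_apply_implicitFunction one_ne_zero hinv
    have hcont : ContinuousAt (fun ε : ℝ => (fderiv ℝ F (ε, φ ε)) ∘L .inr ℝ ℝ (C(I, E) × ℝ)) 0 := by
      have h1 : Continuous (fderiv ℝ F) := hFc.continuous_fderiv one_ne_zero
      have h2 : ContinuousAt (fun ε : ℝ => (ε, φ ε)) 0 := continuousAt_id.prodMk hcontφ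
      have h3 := h1.continuousAt.comp h2
      exact ((ContinuousLinearMap.compL ℝ (C(I, E) × ℝ) (ℝ × (C(I, E) × ℝ))
        (C(I, E) × ℝ)).flip (.inr ℝ ℝ (C(I, E) × ℝ))).continuous.continuousAt.comp h3
    have hop : ∀ᶠ ε in 𝓝 (0:ℝ), ((fderiv ℝ F (ε, φ ε)) ∘L .inr ℝ ℝ (C(I, E) × ℝ)).IsInvertible := by
      rw [← hφ0] at hinv
      obtain ⟨e, he⟩ := hinv
      have := ContinuousLinearEquiv.nhds e
      rw [he] at this
      exact hcont.eventually this
    filter_upwards [hz, hop] with ε h1 h2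
    refine ⟨?_, by rw [hpart]; exact h2⟩
    refine h1.trans ?_
    simp only [hF, h0]
    exact hu.zero
  · have hL : ((fderiv ℝ F (0, u)) ∘L .inr ℝ ℝ (C(I, E) × ℝ)) = fderiv ℝ (periodMap ℓ c G) u := by
      rw [← hpart, h0]
    have hq : fderiv ℝ F (0, u) (1, 0) = (-(u.2 • ContinuousMap.volterra (Q.comp u.1)), 0) := by
      have h1 : HasDerivAt (fun ε : ℝ => ((ε, u) : ℝ × (C(I, E) × ℝ))) (1, 0) 0 :=
        (hasDerivAt_id (0:ℝ)).prodMk (hasDerivAt_const _ _)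
      have h2 := (hFc.differentiable one_ne_zero (0, u)).hasFDerivAt.comp_hasDerivAt (0:ℝ) h1
      have e : F ∘ (fun ε : ℝ => ((ε, u) : ℝ × (C(I, E) × ℝ))) = fun ε : ℝ =>
          periodMap ℓ c G u + ε • (-(u.2 • ContinuousMap.volterra (Q.comp u.1)), (0:ℝ)) := by
        ext1 ε
        have e1 : (G + ε • Q).comp u.1 = G.comp u.1 + ε • Q.comp u.1 := rfl
        simp only [Function.comp, hF, periodMap, e1, map_add, map_smul]
        refine Prod.ext ?_ ?_
        · simp only [Prod.fst_add, Prod.smul_fst]; module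
        · simp
      rw [e] at h2
      have h3 : HasDerivAt (fun ε : ℝ => periodMap ℓ c G u +
          ε • (-(u.2 • ContinuousMap.volterra (Q.comp u.1)), (0:ℝ))) _ 0 :=
        ((hasDerivAt_id (0:ℝ)).smul_const _).const_add _
      rw [h2.unique h3, one_smul]
    simp only [ContinuousLinearMap.comp_apply, neg_apply,
      ContinuousLinearMap.inl_apply, hL]
    rw [hq, norm_neg, mul_assoc]
    refine (ContinuousLinearMap.le_opNorm _ _).trans
      (mul_le_mul_of_nonneg_left ?_ (norm_nonneg _))
    rw [Prod.norm_mk, norm_neg, norm_zero, max_eq_left (norm_nonneg _), norm_smul, Real.norm_eq_abs]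
    refine mul_le_mul_of_nonneg_left ((ContinuousMap.norm_volterra_le _).trans_eq ?_)
      (abs_nonneg _)
    refine intervalIntegral.integral_congr fun s hs => ?_
    rw [uIcc_of_le zero_le_one] at hs
    exact (congrArg (fun z => ‖Q z‖)
      (profile_eq_IccExtend (apply_zero_eq_apply_one hu.zero) hs)).symm

end PeriodMap

section LinearODE
variable {E : Type*} [NormedAddCommGroup E] [NormedSpace ℝ E]

theorem linearODE_unique {A : ℝ → E →L[ℝ] E} {K : ℝ} (hA : ∀ t, ‖A t‖ ≤ K) {b v w : ℝ → E}
    (hv : ∀ t, HasDerivAt v (A t (v t) + b t) t) (hw : ∀ t, HasDerivAt w (A t (w t) + b t) t)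
    {a : ℝ} (h : v a = w a) : v = w := by
  have hL : ∀ t, LipschitzOnWith K.toNNReal (fun z => A t z + b t) univ := by
    intro t
    refine LipschitzOnWith.of_dist_le_mul fun y _ z _ => ?_
    rw [dist_eq_norm, dist_eq_norm, add_sub_add_right_eq_sub, ← map_sub,
      Real.coe_toNNReal _ ((norm_nonneg _).trans (hA t))]
    exact (A t).le_of_opNorm_le (hA t) _
  exact ODE_solution_unique_univ hL (fun t => ⟨hv t, mem_univ _⟩) (fun t => ⟨hw t, mem_univ _⟩) h

theorem linearODE_unique_Icc {A : ℝ → E →L[ℝ] E} {K : ℝ} (hA : ∀ t, ‖A t‖ ≤ K) {b v w : ℝ → E}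
    (hvc : Continuous v) (hv : ∀ t ∈ Icc (0:ℝ) 1, HasDerivAt v (A t (v t) + b t) t)
    (hw : ∀ t, HasDerivAt w (A t (w t) + b t) t) (h : v 0 = w 0) : EqOn v w (Icc 0 1) := by
  have hL : ∀ t, LipschitzWith K.toNNReal (fun z => A t z + b t) := by
    intro t
    refine LipschitzWith.of_dist_le_mul fun y z => ?_
    rw [dist_eq_norm, dist_eq_norm, add_sub_add_right_eq_sub, ← map_sub,
      Real.coe_toNNReal _ ((norm_nonneg _).trans (hA t))]
    exact (A t).le_of_opNorm_le (hA t) _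
  exact ODE_solution_unique hL hvc.continuousOn
    (fun t ht => (hv t ⟨ht.1, ht.2.le⟩).hasDerivWithinAt)
    (fun t _ => (hw t).continuousAt.continuousWithinAt) (fun t _ => (hw t).hasDerivWithinAt) h

variable [FiniteDimensional ℝ E]

theorem isUnit_fundamental {A : ℝ → E →L[ℝ] E} {K : ℝ} (hA : ∀ t, ‖A t‖ ≤ K)
    {Ψ : ℝ → E →L[ℝ] E} (hΨ0 : Ψ 0 = ContinuousLinearMap.id ℝ E)
    (hΨ : ∀ t, HasDerivAt Ψ ((A t).comp (Ψ t)) t) (t : ℝ) : IsUnit (Ψ t) := by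
  have hinj : Function.Injective (Ψ t) := by
    rw [injective_iff_map_eq_zero]
    intro e he
    have := linearODE_unique hA (b := 0) (v := fun s => Ψ s e) (w := 0) (a := t)
      (fun s => by simpa using (hΨ s).clm_apply (hasDerivAt_const s e))
      (fun s => by simp) he
    have h0 := congrFun this 0
    simpa [hΨ0] using h0
  have hbij : Function.Bijective (Ψ t) :=
    ⟨hinj, (LinearMap.injective_iff_surjective (f := (Ψ t : E →ₗ[ℝ] E))).1 hinj⟩
  rwa [ContinuousLinearMap.isUnit_iff_bijective]

/-- Variation of constants. -/
theorem exists_linearODE_solution {A : ℝ → E →L[ℝ] E} {K : ℝ} (hA : ∀ t, ‖A t‖ ≤ K)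
    {Ψ : ℝ → E →L[ℝ] E} (hΨ0 : Ψ 0 = ContinuousLinearMap.id ℝ E)
    (hΨ : ∀ t, HasDerivAt Ψ ((A t).comp (Ψ t)) t) {b : ℝ → E} (hb : Continuous b) :
    ∃ u : ℝ → E, u 0 = 0 ∧ ∀ t, HasDerivAt u (A t (u t) + b t) t := by
  have : CompleteSpace E := FiniteDimensional.complete ℝ E
  have hunit := isUnit_fundamental hA hΨ0 hΨ
  have hΨc : Continuous Ψ := continuous_iff_continuousAt.2 fun t => (hΨ t).continuousAt
  have hinv : Continuous fun t => Ring.inverse (Ψ t) := continuous_iff_continuousAt.2 fun t => by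
    obtain ⟨e, he⟩ := hunit t
    have h1 := NormedRing.inverse_continuousAt e
    rw [he] at h1
    exact h1.comp hΨc.continuousAt
  have hc : Continuous fun t => Ring.inverse (Ψ t) (b t) := hinv.clm_apply hb
  refine ⟨fun t => Ψ t (∫ s in (0:ℝ)..t, Ring.inverse (Ψ s) (b s)), by simp, fun t => ?_⟩
  have h1 := intervalIntegral.integral_hasDerivAt_right (hc.intervalIntegrable 0 t)
    (hc.stronglyMeasurableAtFilter _ _) hc.continuousAt
  have h2 := (hΨ t).clm_apply h1
  rwa [← mul_apply_eq_comp (Ψ t) (Ring.inverse (Ψ t)), Ring.mul_inverse_cancel _ (hunit t)] at h2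

end LinearODE

section Nondegeneracy
theorem integral_IccExtend_congr {E : Type*} [NormedAddCommGroup E] [NormedSpace ℝ E] (h : C(I, E))
    {g : ℝ → E} (hg : ∀ s : I, h s = g s) (t : I) :
    ∫ s in (0:ℝ)..t, IccExtend (zero_le_one' ℝ) h s = ∫ s in (0:ℝ)..t, g s := by
  refine intervalIntegral.integral_congr fun s hs => ?_
  rw [uIcc_of_le t.2.1] at hs
  have hs' : s ∈ Icc (0:ℝ) 1 := ⟨hs.1, hs.2.trans t.2.2⟩
  exact (IccExtend_of_mem (zero_le_one' ℝ) h hs').trans (hg ⟨s, hs'⟩)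

variable {E : Type*} [NormedAddCommGroup E] [NormedSpace ℝ E] [FiniteDimensional ℝ E]

/-- Solvability of the periodic boundary value problem for `w' = A w + ς b`, in integrated form. -/
theorem bijective_periodic_bvp {A : ℝ → E →L[ℝ] E} {K : ℝ} (hA : ∀ t, ‖A t‖ ≤ K)
    (hAc : Continuous A) {Ψ : ℝ → E →L[ℝ] E} (hΨ0 : Ψ 0 = ContinuousLinearMap.id ℝ E)
    (hΨ : ∀ t, HasDerivAt Ψ ((A t).comp (Ψ t)) t) {b : ℝ → E}
    (hb : ∀ t, HasDerivAt b (A t (b t)) t) (hb1 : b 1 = b 0) (ℓ : E →L[ℝ] ℝ) (hℓ : ℓ (b 0) ≠ 0)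
    (hM : ∀ (e : E) (s : ℝ), Ψ 1 e - e = s • b 0 → s = 0 ∧ ∃ κ : ℝ, e = κ • b 0)
    (L : C(I, E) × ℝ → C(I, E) × ℝ)
    (hL1 : ∀ w t, (L w).1 t = w.1 t - w.1 1 -
      (∫ s in (0:ℝ)..t, A s (IccExtend (zero_le_one' ℝ) w.1 s)) - w.2 • ∫ s in (0:ℝ)..t, b s)
    (hL2 : ∀ w, (L w).2 = ℓ (w.1 0)) :
    (∀ w, L w = 0 → w = 0) ∧ Function.Surjective L := by
  have : CompleteSpace E := FiniteDimensional.complete ℝ E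
  have hbc : Continuous b := continuous_iff_continuousAt.2 fun t => (hb t).continuousAt
  have hker : ∀ (e : E) (ς : ℝ), e - Ψ 1 e - ς • b 0 = 0 → ℓ e = 0 → e = 0 ∧ ς = 0 := by
    intro e ς h1 h2
    obtain ⟨hs, κ, rfl⟩ := hM e (-ς) (by
      rw [sub_eq_zero] at h1
      rw [neg_smul, ← h1]; abel)
    rw [map_smul, smul_eq_mul, mul_eq_zero, or_iff_left hℓ] at h2
    exact ⟨by simp [h2], by simpa using hs⟩
  have hsol : ∀ (e : E) (ς t : ℝ), HasDerivAt (fun t => Ψ t e + (ς * t) • b t)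
      (A t (Ψ t e + (ς * t) • b t) + ς • b t) t := by
    intro e ς t
    have h1 := ((hΨ t).clm_apply (hasDerivAt_const t e)).add
      (((hasDerivAt_id t).const_mul ς).smul (hb t))
    have e : A t (Ψ t e + (ς * t) • b t) + ς • b t = ((A t).comp (Ψ t)) e + Ψ t 0 +
        ((ς * id t) • A t (b t) + (ς * 1) • b t) := by
      simp [add_assoc]
    rw [e]
    exact h1
  constructor
  · rintro ⟨w, ς⟩ hw
    have h1 : ∀ t : I, w t = w 1 + (∫ s in (0:ℝ)..t, A s (IccExtend (zero_le_one' ℝ) w s)) +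
        ς • ∫ s in (0:ℝ)..t, b s := by
      intro t
      have := hL1 (w, ς) t
      rw [hw] at this
      simp only [Prod.fst_zero, ContinuousMap.zero_apply] at this
      rw [eq_comm, sub_eq_zero, sub_eq_iff_eq_add, sub_eq_iff_eq_add] at this
      rw [this]; abel
    have h2 : ℓ (w 0) = 0 := by
      have := hL2 (w, ς)
      rw [hw] at this
      exact this.symm
    have hwc := w.continuous_IccExtend_unit
    have hAw : Continuous fun s => A s (IccExtend (zero_le_one' ℝ) w s) := hAc.clm_apply hwc
    let W : ℝ → E := fun τ => w 1 + (∫ s in (0:ℝ)..τ, A s (IccExtend (zero_le_one' ℝ) w s)) +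
        ς • ∫ s in (0:ℝ)..τ, b s
    have hW : ∀ τ, HasDerivAt W (A τ (IccExtend (zero_le_one' ℝ) w τ) + ς • b τ) τ := by
      intro τ
      exact ((intervalIntegral.integral_hasDerivAt_right (hAw.intervalIntegrable _ _)
        (hAw.stronglyMeasurableAtFilter _ _) hAw.continuousAt).const_add _).add
        ((intervalIntegral.integral_hasDerivAt_right (hbc.intervalIntegrable _ _)
        (hbc.stronglyMeasurableAtFilter _ _) hbc.continuousAt).const_smul ς)
    have hWw : ∀ τ (hτ : τ ∈ Icc (0:ℝ) 1), w ⟨τ, hτ⟩ = W τ := fun τ hτ => h1 ⟨τ, hτ⟩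
    have heq : EqOn W (fun t => Ψ t (w 1) + (ς * t) • b t) (Icc 0 1) := by
      refine linearODE_unique_Icc hA (b := fun t => ς • b t)
        (continuous_iff_continuousAt.2 fun t => (hW t).continuousAt) (fun t ht => ?_)
        (hsol (w 1) ς) (by simp [W, hΨ0])
      have := hW t
      rwa [IccExtend_of_mem _ _ ht, hWw] at this
    have hend : w 1 = Ψ 1 (w 1) + ς • b 0 := by
      have := (hWw 1 ⟨zero_le_one, le_rfl⟩).trans (heq ⟨zero_le_one, le_rfl⟩)
      simp only [mul_one, hb1] at this
      exact this
    have hstart : w 0 = w 1 := by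
      have := (hWw 0 ⟨le_rfl, zero_le_one⟩).trans (heq ⟨le_rfl, zero_le_one⟩)
      simp only [mul_zero, zero_smul, add_zero, hΨ0, ContinuousLinearMap.id_apply] at this
      exact this
    obtain ⟨h3, rfl⟩ := hker (w 1) ς (by rw [sub_sub, sub_eq_zero]; exact hend) (hstart ▸ h2)
    refine Prod.ext ?_ rfl
    ext τ
    have := (hWw τ τ.2).trans (heq τ.2)
    simpa [h3] using this
  · rintro ⟨h, ρ⟩
    have hhc := h.continuous_IccExtend_unit
    obtain ⟨u, hu0, hu⟩ := exists_linearODE_solution hA hΨ0 hΨ (hAc.clm_apply hhc)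
    let B : (E × ℝ) →ₗ[ℝ] (E × ℝ) :=
      { toFun := fun z => (z.1 - Ψ 1 z.1 - z.2 • b 0, ℓ z.1)
        map_add' := fun y z => by
          refine Prod.ext ?_ ?_
          · simp only [Prod.fst_add, Prod.snd_add, map_add, add_smul]; abel
          · simp
        map_smul' := fun r z => by
          refine Prod.ext ?_ ?_
          · simp [smul_sub, mul_smul]
          · simp }
    have hBinj : Function.Injective B := by
      rw [injective_iff_map_eq_zero]
      rintro ⟨e, ς⟩ hz
      obtain ⟨rfl, rfl⟩ := hker e ς (congrArg Prod.fst hz) (congrArg Prod.snd hz)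
      rfl
    obtain ⟨⟨e, ς⟩, heς⟩ := (LinearMap.injective_iff_surjective.1 hBinj) (u 1 + h 1, ρ - ℓ (h 0))
    have he1 : e - Ψ 1 e - ς • b 0 = u 1 + h 1 := congrArg Prod.fst heς
    have he2 : ℓ e = ρ - ℓ (h 0) := congrArg Prod.snd heς
    let W : ℝ → E := fun t => (Ψ t e + (ς * t) • b t) + u t
    have hW : ∀ t, HasDerivAt W (A t (W t + IccExtend (zero_le_one' ℝ) h t) + ς • b t) t := by
      intro t
      have e1 : A t (W t + IccExtend (zero_le_one' ℝ) h t) + ς • b t =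
          A t (Ψ t e + (ς * t) • b t) + ς • b t +
            (A t (u t) + A t (IccExtend (zero_le_one' ℝ) h t)) := by
        simp only [W, map_add]; abel
      rw [e1]
      exact (hsol e ς t).add (hu t)
    have hWc : Continuous W := continuous_iff_continuousAt.2 fun t => (hW t).continuousAt
    let w : C(I, E) := ⟨fun t => W t, hWc.comp continuous_subtype_val⟩
    have hw1 : w 1 + h 1 = e := by
      have : w 1 = Ψ 1 e + ς • b 0 + u 1 := by simp [w, W, hb1]
      rw [this, add_assoc, ← he1]; abel
    refine ⟨(w + h, ς), Prod.ext ?_ ?_⟩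
    · ext t
      rw [hL1]
      rw [ContinuousMap.add_apply, ContinuousMap.add_apply]
      have hcont : Continuous fun s => A s (W s + IccExtend (zero_le_one' ℝ) h s) :=
        hAc.clm_apply (hWc.add hhc)
      have h1 : ∫ s in (0:ℝ)..t, A s (IccExtend (zero_le_one' ℝ) (w + h : C(I, E)) s) =
          ∫ s in (0:ℝ)..t, A s (W s + IccExtend (zero_le_one' ℝ) h s) := by
        refine intervalIntegral.integral_congr fun s hs => ?_
        rw [uIcc_of_le t.2.1] at hs
        have hs' : s ∈ Icc (0:ℝ) 1 := ⟨hs.1, hs.2.trans t.2.2⟩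
        simp only [IccExtend_of_mem _ _ hs', ContinuousMap.coe_add, Pi.add_apply]
        rfl
      have h2 : ∫ s in (0:ℝ)..t, (A s (W s + IccExtend (zero_le_one' ℝ) h s) + ς • b s) =
          W t - W 0 := intervalIntegral.integral_eq_sub_of_hasDerivAt (fun s _ => hW s)
          ((hcont.add (hbc.const_smul ς)).intervalIntegrable _ _)
      have hbi : IntervalIntegrable (fun s => ς • b s) volume 0 t :=
        (hbc.const_smul ς).intervalIntegrable _ _
      rw [intervalIntegral.integral_add (hcont.intervalIntegrable _ _)
        hbi, intervalIntegral.integral_smul] at h2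
      have hW0 : W 0 = e := by simp [W, hΨ0, hu0]
      refine (congrArg
          (fun z => w t + h t - (w 1 + h 1) - z - ς • ∫ s in (0:ℝ)..t, b s) h1).trans ?_
      rw [sub_sub, h2, hw1, hW0]
      simp only [w, ContinuousMap.coe_mk]
      abel
    · rw [hL2]
      have : w 0 = e := by simp [w, W, hΨ0, hu0]
      simp [this, he2]

/-- Invertibility of the linearized period map at a hyperbolic orbit. -/
theorem IsHyperbolicOrbit.isNondegenerateZero {f : C(E, E)} (hf : ContDiff ℝ 1 f) {x : ℝ → E}
    {T : ℝ} (hx : IsHyperbolicOrbit f x T) (hxc : Continuous x) (t₀ : ℝ) (ℓ : E →L[ℝ] ℝ)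
    (hℓ : ℓ (f (x t₀)) ≠ 0) :
    IsNondegenerateZero ℓ (ℓ (x t₀)) f
      ((⟨fun τ : I => x (t₀ + T * τ), by fun_prop⟩ : C(I, E)), T) := by
  have : CompleteSpace E := FiniteDimensional.complete ℝ E
  obtain ⟨⟨hT, hsol, hper, -⟩, Φ, hΦ0, hΦ, hmult, -⟩ := hx
  have hdf : Continuous (fderiv ℝ f) := hf.continuous_fderiv one_ne_zero
  have hdfx : Continuous fun t => fderiv ℝ f (x t) := hdf.comp hxc
  obtain ⟨K, hK⟩ : ∃ K, ∀ t, ‖fderiv ℝ f (x t)‖ ≤ K := by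
    have hp : Function.Periodic (fun t => ‖fderiv ℝ f (x t)‖) T := fun t => by simp only [hper t]
    obtain ⟨K, hK⟩ := (isCompact_Icc (a := (0:ℝ)) (b := T)).bddAbove_image
      hdfx.norm.continuousOn
    refine ⟨K, fun t => ?_⟩
    obtain ⟨s, hs, hst⟩ := hp.exists_mem_Ico₀ hT t
    rw [hst]
    exact hK ⟨s, ⟨hs.1, hs.2.le⟩, rfl⟩
  have hunit := isUnit_fundamental hK hΦ0 hΦ
  have hbx : ∀ t, HasDerivAt (fun t => f (x t)) (fderiv ℝ f (x t) (f (x t))) t := fun t =>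
    (hf.differentiable one_ne_zero (x t)).hasFDerivAt.comp_hasDerivAt t (hsol t)
  have hΦv : ∀ e t, HasDerivAt (fun t => Φ t e) (fderiv ℝ f (x t) (Φ t e) + 0) t := fun e t => by
    simpa using (hΦ t).clm_apply (hasDerivAt_const t e)
  have hvel : ∀ t, f (x t) = Φ t (f (x 0)) := fun t => congrFun (linearODE_unique hK (b := 0)
    (v := fun t => f (x t)) (w := fun t => Φ t (f (x 0))) (a := 0)
    (fun s => by simpa using hbx s) (hΦv _) (by simp [hΦ0])) t
  have hmono : ∀ e, Φ (t₀ + T) e = Φ t₀ (Φ T e) := fun e =>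
    congrFun (linearODE_unique hK (b := 0) (v := fun t => Φ (t + T) e)
      (w := fun t => Φ t (Φ T e)) (a := 0)
      (fun s => by
        have := (hΦv e (s + T)).comp_add_const s T
        rwa [hper] at this) (hΦv _) (by simp [hΦ0])) t₀
  have hp0 : f (x 0) ≠ 0 := fun h => hℓ (by rw [hvel t₀, h]; simp)
  have hMp : Φ T (f (x 0)) = f (x 0) := by
    rw [← hvel T]
    have := hper 0
    rw [zero_add] at this
    rw [this]
  have hgen : ∀ (e : E) (s : ℝ), Φ T e - e = s • f (x 0) → s = 0 ∧ ∃ κ : ℝ, e = κ • f (x 0) := by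
    intro e s he
    set N : Module.End ℝ E := (Φ T : E →ₗ[ℝ] E) with hN
    have hfr : Module.finrank ℝ (N.maxGenEigenspace 1) = 1 := by
      rw [LinearMap.finrank_maxGenEigenspace_eq, ← hmult,
        Polynomial.eq_rootMultiplicity_map (FaithfulSMul.algebraMap_injective ℝ ℂ) 1, map_one]
    have hpmem : f (x 0) ∈ N.maxGenEigenspace 1 := by
      rw [Module.End.mem_maxGenEigenspace]
      exact ⟨1, by simp [hN, hMp]⟩
    have hemem : e ∈ N.maxGenEigenspace 1 := by
      rw [Module.End.mem_maxGenEigenspace]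
      refine ⟨2, ?_⟩
      have h1 : (N - (1:ℝ) • (1 : Module.End ℝ E)) e = s • f (x 0) := by simp [hN, he]
      rw [pow_two, Module.End.mul_apply, h1]
      simp [hN, hMp]
    obtain ⟨κ, hκ⟩ := exists_smul_eq_of_finrank_eq_one hfr
      (x := ⟨f (x 0), hpmem⟩) (fun h => hp0 (congrArg Subtype.val h)) ⟨e, hemem⟩
    have hκ' : e = κ • f (x 0) := (congrArg Subtype.val hκ).symm
    refine ⟨?_, κ, hκ'⟩
    rw [hκ', map_smul, hMp, sub_self, eq_comm, smul_eq_zero] at he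
    exact he.resolve_right hp0
  have hline : ∀ τ : ℝ, HasDerivAt (fun τ => t₀ + T * τ) T τ := fun τ => by
    simpa using ((hasDerivAt_id τ).const_mul T).const_add t₀
  set P := Φ t₀ with hP
  have hPinv : ∀ e, P (Ring.inverse P e) = e := fun e => by
    rw [← mul_apply_eq_comp, Ring.mul_inverse_cancel _ (hunit t₀)]; rfl
  have hPinj : Function.Injective P := ((ContinuousLinearMap.isUnit_iff_bijective).1 (hunit t₀)).1
  have hξ : ∀ τ, HasDerivAt (fun τ => x (t₀ + T * τ)) (T • f (x (t₀ + T * τ))) τ := fun τ =>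
    (hsol (t₀ + T * τ)).scomp τ (hline τ)
  constructor
  · rw [periodMap_eq_zero_iff]
    refine ⟨fun t => ?_, by simp⟩
    have hc : Continuous fun τ => f (x (t₀ + T * τ)) := by fun_prop
    have h1 : ContinuousMap.volterra (f.comp (⟨fun τ : I => x (t₀ + T * τ), by fun_prop⟩ : C(I, E)))
        t = ∫ s in (0:ℝ)..t, f (x (t₀ + T * s)) := by
      rw [ContinuousMap.volterra_apply]
      exact integral_IccExtend_congr (f.comp (⟨fun τ : I => x (t₀ + T * τ), by fun_prop⟩ : C(I, E)))
        (g := fun s => f (x (t₀ + T * s))) (fun _ => rfl) t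
    rw [h1, ← intervalIntegral.integral_smul,
      intervalIntegral.integral_eq_sub_of_hasDerivAt (fun s _ => hξ s)
        ((hc.const_smul T).intervalIntegrable _ _)]
    simp [hper]
  · set u : C(I, E) × ℝ := ((⟨fun τ : I => x (t₀ + T * τ), by fun_prop⟩ : C(I, E)), T) with hu
    have hb' : ∀ τ, HasDerivAt (fun τ => f (x (t₀ + T * τ)))
        ((T • fderiv ℝ f (x (t₀ + T * τ))) (f (x (t₀ + T * τ)))) τ := fun τ =>
      HasDerivAt.scomp (h := fun τ => t₀ + T * τ) τ (hbx (t₀ + T * τ)) (hline τ)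
    have hΨ' : ∀ τ, HasDerivAt (fun τ => (Φ (t₀ + T * τ)).comp (Ring.inverse P))
        ((T • fderiv ℝ f (x (t₀ + T * τ))).comp ((Φ (t₀ + T * τ)).comp (Ring.inverse P))) τ :=
      fun τ => by
        have h1 : HasDerivAt (fun τ => Φ (t₀ + T * τ))
            (T • (fderiv ℝ f (x (t₀ + T * τ))).comp (Φ (t₀ + T * τ))) τ :=
          HasDerivAt.scomp (h := fun τ => t₀ + T * τ) τ (hΦ (t₀ + T * τ)) (hline τ)
        have h2 := h1.clm_comp (hasDerivAt_const τ (Ring.inverse P))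
        rw [ContinuousLinearMap.comp_zero, add_zero] at h2
        exact h2
    have hM' : ∀ (e : E) (s : ℝ), ((Φ (t₀ + T * 1)).comp (Ring.inverse P)) e - e =
        s • f (x (t₀ + T * 0)) → s = 0 ∧ ∃ κ : ℝ, e = κ • f (x (t₀ + T * 0)) := by
      intro e s h
      rw [mul_one, mul_zero, add_zero, ContinuousLinearMap.comp_apply] at h
      rw [mul_zero, add_zero]
      have he := hPinv e
      set e' := Ring.inverse P e with he'
      have h2 : P (Φ T e' - e') = P (s • f (x 0)) := by
        rw [map_sub, ← hmono, map_smul, hP, ← hvel t₀, ← h, ← hP, he]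
      obtain ⟨hs, κ, hκ⟩ := hgen e' s (hPinj h2)
      exact ⟨hs, κ, by rw [← he, hκ, map_smul, hvel t₀]⟩
    have hL1 : ∀ (w : C(I, E) × ℝ) (t : I), (fderiv ℝ (periodMap ℓ (ℓ (x t₀)) f) u w).1 t =
        w.1 t - w.1 1 - (∫ s in (0:ℝ)..t, (T • fderiv ℝ f (x (t₀ + T * s)))
          (IccExtend (zero_le_one' ℝ) w.1 s)) - w.2 • ∫ s in (0:ℝ)..t, f (x (t₀ + T * s)) := by
      intro w t
      rw [fderiv_periodMap hf]
      simp only [ContinuousMap.sub_apply, ContinuousMap.smul_apply, ContinuousMap.const_apply,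
        ContinuousMap.volterra_apply]
      have h1 := integral_IccExtend_congr (f.comp u.1) (g := fun s => f (x (t₀ + T * s)))
        (fun _ => rfl) t
      have h2 := integral_IccExtend_congr (ContinuousMap.applyL
        ((⟨fderiv ℝ f, hdf⟩ : C(E, E →L[ℝ] E)).comp u.1) w.1)
        (g := fun s => fderiv ℝ f (x (t₀ + T * s)) (IccExtend (zero_le_one' ℝ) w.1 s))
        (fun s => by rw [IccExtend_val]; rfl) t
      rw [h1, h2, ← intervalIntegral.integral_smul]
      rfl
    obtain ⟨hinj, hsurj⟩ := bijective_periodic_bvp (A := fun τ => T • fderiv ℝ f (x (t₀ + T * τ)))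
      (K := |T| * K)
      (fun τ => by
        rw [norm_smul, Real.norm_eq_abs]
        exact mul_le_mul_of_nonneg_left (hK _) (abs_nonneg _))
      (by fun_prop) (by ext e; simpa using hPinv e) hΨ' hb' (by simp [hper]) ℓ (by simpa using hℓ)
      hM' (fderiv ℝ (periodMap ℓ (ℓ (x t₀)) f) u) hL1 (fun w => by rw [fderiv_periodMap hf])
    have hker : (fderiv ℝ (periodMap ℓ (ℓ (x t₀)) f) u).ker = ⊥ := by
      rw [eq_bot_iff]
      exact fun w hw => hinj w hw
    have hrange : (fderiv ℝ (periodMap ℓ (ℓ (x t₀)) f) u).range = ⊤ :=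
      LinearMap.range_eq_top.2 hsurj
    exact ⟨ContinuousLinearEquiv.ofBijective _ hker hrange,
      ContinuousLinearEquiv.coe_ofBijective _ _ _⟩

end Nondegeneracy

section Transport

/-- `transport` as a linear isometry. -/
noncomputable def transportL {m n : ℕ} (h : m = n) :
    EuclideanSpace ℝ (Fin m) →ₗᵢ[ℝ] EuclideanSpace ℝ (Fin n) where
  toFun := transport h
  map_add' _ _ := rfl
  map_smul' _ _ := rfl
  norm_map' u := by subst h; rfl

@[simp] theorem transport_rfl {m : ℕ} (u : EuclideanSpace ℝ (Fin m)) : transport rfl u = u := rfl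

@[simp] theorem transport_transport {m n k : ℕ} (h : m = n) (h' : n = k)
    (u : EuclideanSpace ℝ (Fin m)) : transport h' (transport h u) = transport (h.trans h') u := by
  subst h h'; rfl

theorem transport_add {m n : ℕ} (h : m = n) (u v : EuclideanSpace ℝ (Fin m)) :
    transport h (u + v) = transport h u + transport h v := rfl

theorem transport_smul {m n : ℕ} (h : m = n) (r : ℝ) (u : EuclideanSpace ℝ (Fin m)) :
    transport h (r • u) = r • transport h u := rfl

theorem transport_zero {m n : ℕ} (h : m = n) : transport h 0 = 0 := rfl

theorem norm_transport {m n : ℕ} (h : m = n) (u : EuclideanSpace ℝ (Fin m)) :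
    ‖transport h u‖ = ‖u‖ := (transportL h).norm_map u

theorem dist_transport {m n : ℕ} (h : m = n) (u v : EuclideanSpace ℝ (Fin m)) :
    dist (transport h u) (transport h v) = dist u v := (transportL h).dist_map u v

theorem transport_injective {m n : ℕ} (h : m = n) : Function.Injective (transport h) :=
  (transportL h).injective

end Transport

namespace Network

variable {C A : Type*} {G : Network C A}

namespace InputIso

/-- The inverse of an input isomorphism. -/
def symm {c d : C} (β : G.InputIso c d) : G.InputIso d c where
  toEquiv := β.toEquiv.symm
  node_rel := G.nodeType.symm' β.node_rel
  arrow_rel a := G.arrowType.symm' (by simpa using β.arrow_rel (β.toEquiv.symm a))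

/-- The composite of two input isomorphisms. -/
def trans {c d e : C} (β : G.InputIso c d) (γ : G.InputIso d e) : G.InputIso c e where
  toEquiv := β.toEquiv.trans γ.toEquiv
  node_rel := G.nodeType.trans' β.node_rel γ.node_rel
  arrow_rel a := G.arrowType.trans' (β.arrow_rel a) (γ.arrow_rel _)

/-- The identity input isomorphism. -/
def refl (c : C) : G.InputIso c c where
  toEquiv := Equiv.refl _
  node_rel := G.nodeType.refl' c
  arrow_rel _ := G.arrowType.refl' _

theorem toEquiv_injective {c d : C} :
    Function.Injective (toEquiv : G.InputIso c d → (G.Input c ≃ G.Input d)) := by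
  rintro ⟨β, _, _⟩ ⟨γ, _, _⟩ rfl
  rfl

/-- Composition with a fixed input isomorphism. -/
def transEquiv {c d : C} (e : C) (γ : G.InputIso c d) : G.InputIso e c ≃ G.InputIso e d where
  toFun β := β.trans γ
  invFun β := β.trans γ.symm
  left_inv β := toEquiv_injective (by ext a; simp [trans, symm])
  right_inv β := toEquiv_injective (by ext a; simp [trans, symm])

instance [Finite A] {c d : C} : Finite (G.InputIso c d) :=
  Finite.of_injective _ toEquiv_injective

noncomputable instance [Finite A] {c d : C} : Fintype (G.InputIso c d) := Fintype.ofFinite _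

end InputIso

noncomputable instance [Finite A] {c : C} : Fintype (G.Input c) := Fintype.ofFinite _

namespace NodeSpaces

variable {D : G.NodeSpaces}

theorem SameState.refl (z : D.State) (e : C) : D.SameState z z e e := ⟨rfl, rfl⟩

theorem SameState.symm {z y : D.State} {e e' : C} (h : D.SameState z y e e') :
    D.SameState y z e' e := by
  obtain ⟨h1, h2⟩ := h
  exact ⟨h1.symm, by rw [← h2]; simp⟩

theorem SameState.trans {z y x : D.State} {e e' e'' : C} (h : D.SameState z y e e')
    (h' : D.SameState y x e' e'') : D.SameState z x e e'' := by
  obtain ⟨h1, h2⟩ := h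
  obtain ⟨h3, h4⟩ := h'
  exact ⟨h1.trans h3, by rw [← h4, ← h2]; simp⟩

theorem SameState.smul {z y : D.State} {e e' : C} (r : ℝ) (h : D.SameState z y e e') :
    D.SameState (r • z) (r • y) e e' := by
  obtain ⟨h1, h2⟩ := h
  exact ⟨h1, by rw [Pi.smul_apply, Pi.smul_apply, transport_smul, h2]⟩

theorem SameState.eq_zero_iff {z y : D.State} {e e' : C} (h : D.SameState z y e e') :
    z e = 0 ↔ y e' = 0 := by
  obtain ⟨h1, h2⟩ := h
  rw [← h2, ← norm_eq_zero (a := z e), ← norm_eq_zero (a := transport h1 (z e)), norm_transport]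

theorem SameState.norm_eq {z y : D.State} {e e' : C} (h : D.SameState z y e e') :
    ‖z e‖ = ‖y e'‖ := by
  obtain ⟨h1, h2⟩ := h
  rw [← h2, norm_transport]

theorem IsAdmissible.sameState {f : D.State → D.State} (hf : D.IsAdmissible f) {z y : D.State}
    {e e' : C} (β : G.InputIso e e') (h : D.SameState z y e e')
    (h' : ∀ a : G.Input e, D.SameState z y (G.tail a.1) (G.tail (β.toEquiv a).1)) :
    D.SameState (f z) (f y) e e' := by
  obtain ⟨g, hg, hβ⟩ := hf
  refine ⟨D.dim_node β, ?_⟩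
  rw [hg, hg, hβ e e' β]
  congr 1
  obtain ⟨h1, h2⟩ := h
  congr 1
  · rw [← h2]; simp
  · ext1 a
    obtain ⟨h3, h4⟩ := h' a
    simp only [pullback]
    rw [← h4]; simp

theorem IsAdmissible.add {f g : D.State → D.State} (hf : D.IsAdmissible f)
    (hg : D.IsAdmissible g) : D.IsAdmissible (f + g) := by
  obtain ⟨F, hF, hFβ⟩ := hf
  obtain ⟨K, hK, hKβ⟩ := hg
  refine ⟨fun c u v => F c u v + K c u v, fun x c => ?_, fun c d β u v => ?_⟩
  · rw [Pi.add_apply, Pi.add_apply, hF, hK]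
  · beta_reduce
    rw [hFβ c d β, hKβ c d β, transport_add]

theorem IsAdmissible.const_smul {f : D.State → D.State} (hf : D.IsAdmissible f) (r : ℝ) :
    D.IsAdmissible (r • f) := by
  obtain ⟨F, hF, hFβ⟩ := hf
  refine ⟨fun c u v => r • F c u v, fun x c => ?_, fun c d β u v => ?_⟩
  · rw [Pi.smul_apply, Pi.smul_apply, hF]
  · beta_reduce
    rw [hFβ c d β, transport_smul]

theorem isAdmissible_zero : D.IsAdmissible 0 :=
  ⟨fun _ _ _ => 0, fun _ _ => rfl, fun _ _ _ _ _ => rfl⟩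

theorem SameState.of_hasDerivAt {Z Y : ℝ → D.State} {v w : D.State} {t : ℝ} {e e' : C}
    (hZ : HasDerivAt Z v t) (hY : HasDerivAt Y w t)
    (h : ∀ᶠ s in 𝓝 t, D.SameState (Z s) (Y s) e e') : D.SameState v w e e' := by
  obtain ⟨hd, -⟩ := h.self_of_nhds
  refine ⟨hd, ?_⟩
  have h1 : HasDerivAt (fun s => transportL hd (Z s e)) (transportL hd (v e)) t :=
    (transportL hd).toContinuousLinearMap.hasFDerivAt.comp_hasDerivAt t (hasDerivAt_pi.1 hZ e)
  have h2 : HasDerivAt (fun s => Y s e') (w e') t := hasDerivAt_pi.1 hY e'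
  refine h1.unique (h2.congr_of_eventuallyEq ?_)
  filter_upwards [h] with s hs
  exact hs.2

theorem isClosed_sameState {X : Type*} [TopologicalSpace X] {Z Y : X → D.State}
    (hZ : Continuous Z) (hY : Continuous Y) (e e' : C) :
    IsClosed {s | D.SameState (Z s) (Y s) e e'} := by
  by_cases hd : D.dim e = D.dim e'
  · have : {s | D.SameState (Z s) (Y s) e e'} = {s | transportL hd (Z s e) = Y s e'} := by
      ext s; exact ⟨fun h => h.2, fun h => ⟨hd, h⟩⟩
    rw [this]
    exact isClosed_eq (by fun_prop) (by fun_prop)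
  · have : {s | D.SameState (Z s) (Y s) e e'} = ∅ := by
      ext s; exact ⟨fun h => (hd h.1).elim, fun h => h.elim⟩
    rw [this]; exact isClosed_empty

end NodeSpaces
end Network

namespace Network.NodeSpaces

variable {C A : Type*} {G : Network C A} {D : G.NodeSpaces}

/-- The vector of node and input states of `e`. -/
abbrev InputState (D : G.NodeSpaces) (e : C) : Type _ :=
  D.P e × ((a : G.Input e) → D.P (G.tail a.1))

/-- The input state of `e'`, pulled back to `e`. -/
noncomputable def pullInput (D : G.NodeSpaces) {e e' : C} (β : G.InputIso e e') :
    D.State →L[ℝ] D.InputState e :=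
  ((transportL (D.dim_node β).symm).toContinuousLinearMap.comp (.proj e')).prod
    (.pi fun a => (transportL (D.dim_tail β a).symm).toContinuousLinearMap.comp (.proj _))

theorem pullInput_apply {e e' : C} (β : G.InputIso e e') (z : D.State) :
    D.pullInput β z = (transport (D.dim_node β).symm (z e'),
      D.pullback β fun a => z (G.tail a.1)) := rfl

theorem pullInput_refl {e : C} (z : D.State) :
    D.pullInput (.refl e) z = (z e, fun a : G.Input e => z (G.tail a.1)) := rfl

/-- The states of `X` at `e` and of `z` at `e'` are at distance less than `δ`. -/
def NearState (D : G.NodeSpaces) (δ : ℝ) (X z : D.State) (e e' : C) : Prop :=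
  ∃ h : D.dim e = D.dim e', dist (transport h (X e)) (z e') < δ

/-- The input states of `X` at `e` and of `z` at `e'` agree up to some input isomorphism. -/
def InputSync (D : G.NodeSpaces) (X z : D.State) (e e' : C) : Prop :=
  ∃ β : G.InputIso e e', D.SameState X z e e' ∧
    ∀ a : G.Input e, D.SameState X z (G.tail a.1) (G.tail (β.toEquiv a).1)

theorem IsAdmissible.sameState_of_inputSync {f : D.State → D.State} (hf : D.IsAdmissible f)
    {X z : D.State} {e e' : C} (h : D.InputSync X z e e') : D.SameState (f X) (f z) e e' := by
  obtain ⟨β, h1, h2⟩ := h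
  exact hf.sameState β h1 h2

variable [Fintype C] [Fintype A]

omit [Fintype C] in
theorem dist_pullInput_lt {e e' : C} (β : G.InputIso e e') {X z : D.State} {δ : ℝ}
    (h : dist (D.pullInput β z) (X e, fun a => X (G.tail a.1)) < δ) :
    D.NearState δ X z e e' ∧
      ∀ a : G.Input e, D.NearState δ X z (G.tail a.1) (G.tail (β.toEquiv a).1) := by
  rw [pullInput_apply, Prod.dist_eq, max_lt_iff] at h
  obtain ⟨h1, h2⟩ := h
  refine ⟨⟨D.dim_node β, ?_⟩, fun a => ⟨D.dim_tail β a, ?_⟩⟩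
  · rw [← dist_transport (D.dim_node β)] at h1
    simpa [dist_comm] using h1
  · have h3 := (dist_le_pi_dist _ _ a).trans_lt h2
    rw [← dist_transport (D.dim_tail β a)] at h3
    simpa [dist_comm, pullback] using h3

/-- The admissible vector field obtained by symmetrizing the scalar function `b` of the input
state of `e`. -/
noncomputable def symmetrize (D : G.NodeSpaces) (e : C) (b : D.InputState e → ℝ) (w : D.P e) :
    D.State → D.State :=
  fun z e' => ∑ β : G.InputIso e e', b (D.pullInput β z) • transport (D.dim_node β) w

omit [Fintype C] in
theorem isAdmissible_symmetrize (e : C) (b : D.InputState e → ℝ) (w : D.P e) :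
    D.IsAdmissible (D.symmetrize e b w) := by
  refine ⟨fun c u v => ∑ β : G.InputIso e c, b (transport (D.dim_node β).symm u, D.pullback β v) •
    transport (D.dim_node β) w, fun x c => rfl, fun c d γ u v => ?_⟩
  have h : ∀ (s : Finset (G.InputIso e c)) (F : G.InputIso e c → D.P c),
      transport (D.dim_node γ) (∑ β ∈ s, F β) = ∑ β ∈ s, transport (D.dim_node γ) (F β) :=
    fun s F => map_sum (transportL (D.dim_node γ)) F s
  beta_reduce
  rw [h, ← (InputIso.transEquiv e γ).sum_comp]
  refine Finset.sum_congr rfl fun β _ => ?_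
  rw [transport_smul, transport_transport, transport_transport]
  congr 2

theorem contDiff_symmetrize (e : C) {b : D.InputState e → ℝ} (hb : ContDiff ℝ ∞ b) (w : D.P e) :
    ContDiff ℝ ∞ (D.symmetrize e b w) := by
  rw [contDiff_pi]
  intro e'
  refine ContDiff.sum fun β _ => ?_
  exact (hb.comp (D.pullInput β).contDiff).smul contDiff_const

theorem norm_symmetrize_le (e : C) {b : D.InputState e → ℝ} (hb : ∀ v, |b v| ≤ 1) (w : D.P e)
    (z : D.State) :
    ‖D.symmetrize e b w z‖ ≤ (∑ e' : C, Fintype.card (G.InputIso e e')) * ‖w‖ := by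
  rw [pi_norm_le_iff_of_nonneg (by positivity)]
  intro e'
  refine (norm_sum_le _ _).trans ?_
  have h1 : ∑ β : G.InputIso e e', ‖b (D.pullInput β z) • transport (D.dim_node β) w‖ ≤
      ∑ β : G.InputIso e e', ‖w‖ := by
    refine Finset.sum_le_sum fun β _ => ?_
    rw [norm_smul, norm_transport, Real.norm_eq_abs]
    exact mul_le_of_le_one_left (norm_nonneg _) (hb _)
  refine h1.trans ?_
  rw [Finset.sum_const, nsmul_eq_mul, Finset.card_univ]
  refine mul_le_mul_of_nonneg_right ?_ (norm_nonneg _)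
  exact_mod_cast Finset.single_le_sum (f := fun e' => Fintype.card (G.InputIso e e'))
    (fun _ _ => Nat.zero_le _) (Finset.mem_univ e')

theorem exists_lipschitzWith_symmetrize (e : C) {b : D.InputState e → ℝ} {K : NNReal}
    (hb : LipschitzWith K b) (w : D.P e) : ∃ K', LipschitzWith K' (D.symmetrize e b w) := by
  refine ⟨∑ e' : C, ∑ β : G.InputIso e e', K * ‖D.pullInput β‖₊ * ‖w‖₊, ?_⟩
  refine LipschitzWith.of_dist_le_mul fun z y => ?_
  rw [dist_pi_le_iff (by positivity)]
  intro e'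
  have h1 : dist (D.symmetrize e b w z e') (D.symmetrize e b w y e') ≤
      ∑ β : G.InputIso e e', (K * ‖D.pullInput β‖ * ‖w‖) * dist z y := by
    rw [dist_eq_norm, symmetrize, symmetrize, ← Finset.sum_sub_distrib]
    refine (norm_sum_le _ _).trans (Finset.sum_le_sum fun β _ => ?_)
    rw [← sub_smul, norm_smul, norm_transport, ← dist_eq_norm]
    have h2 := hb.dist_le_mul (D.pullInput β z) (D.pullInput β y)
    have h3 := (D.pullInput β).lipschitz.dist_le_mul z y
    have h4 : dist (b (D.pullInput β z)) (b (D.pullInput β y)) ≤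
        K * (‖D.pullInput β‖ * dist z y) := h2.trans (mul_le_mul_of_nonneg_left h3 K.2)
    calc _ ≤ K * (‖D.pullInput β‖ * dist z y) * ‖w‖ :=
          mul_le_mul_of_nonneg_right h4 (norm_nonneg _)
      _ = _ := by ring
  refine h1.trans ?_
  rw [← Finset.sum_mul]
  refine mul_le_mul_of_nonneg_right ?_ dist_nonneg
  push_cast
  exact Finset.single_le_sum (f := fun e' => ∑ β : G.InputIso e e', (K : ℝ) * ‖D.pullInput β‖ * ‖w‖)
    (fun _ _ => Finset.sum_nonneg fun _ _ => by positivity) (Finset.mem_univ e')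

theorem c1Norm_lt_top {E : Type*} [NormedAddCommGroup E] [NormedSpace ℝ E] {p : E → E} {B : ℝ}
    {K : NNReal} (hB : ∀ z, ‖p z‖ ≤ B) (hK : LipschitzWith K p) : c1Norm p < ⊤ := by
  have : c1Norm p ≤ max (ENNReal.ofReal B) K := by
    refine iSup_le fun z => max_le_max ?_ ?_
    · rw [← ofReal_norm]
      exact ENNReal.ofReal_le_ofReal (hB z)
    · have := norm_fderiv_le_of_lipschitz ℝ (x₀ := z) hK
      rw [← ofReal_norm, ← ENNReal.ofReal_coe_nnreal]
      exact ENNReal.ofReal_le_ofReal this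
  exact this.trans_lt (max_lt ENNReal.ofReal_lt_top ENNReal.coe_lt_top)

theorem c1Norm_add_smul_le {E : Type*} [NormedAddCommGroup E] [NormedSpace ℝ E] {p q : E → E}
    (hp : Differentiable ℝ p) (hq : Differentiable ℝ q) (r : ℝ) :
    c1Norm (p + r • q) ≤ c1Norm p + ‖r‖ₑ * c1Norm q := by
  refine iSup_le fun z => max_le ?_ ?_
  · refine (enorm_add_le _ _).trans (add_le_add ?_ ?_)
    · exact (le_max_left _ _).trans (le_iSup (fun z => max ‖p z‖ₑ ‖fderiv ℝ p z‖ₑ) z)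
    · rw [Pi.smul_apply, enorm_smul]
      exact mul_le_mul_right ((le_max_left _ _).trans
        (le_iSup (fun z => max ‖q z‖ₑ ‖fderiv ℝ q z‖ₑ) z)) _
  · rw [fderiv_add (hp z) ((hq z).const_smul r), fderiv_const_smul (hq z)]
    refine (enorm_add_le _ _).trans (add_le_add ?_ ?_)
    · exact (le_max_right _ _).trans (le_iSup (fun z => max ‖p z‖ₑ ‖fderiv ℝ p z‖ₑ) z)
    · rw [enorm_smul]
      exact mul_le_mul_right ((le_max_right _ _).trans
        (le_iSup (fun z => max ‖q z‖ₑ ‖fderiv ℝ q z‖ₑ) z)) _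

omit [Fintype A] in
theorem IsPerturbation.eventually_add_smul {p q : D.State → D.State} {ε : ℝ}
    (hp : D.IsPerturbation p ε) (hq : D.IsAdmissible q) (hqs : ContDiff ℝ ∞ q)
    (hqn : c1Norm q < ⊤) : ∀ᶠ r : ℝ in 𝓝 0, D.IsPerturbation (p + r • q) ε := by
  have h1 : Tendsto (fun r : ℝ => c1Norm p + ‖r‖ₑ * c1Norm q) (𝓝 0) (𝓝 (c1Norm p)) := by
    have h2 : Tendsto (fun r : ℝ => ‖r‖ₑ) (𝓝 0) (𝓝 0) := by
      simpa using (continuous_enorm (E := ℝ)).tendsto 0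
    have h3 := ENNReal.Tendsto.mul_const (b := c1Norm q) h2 (Or.inr hqn.ne)
    simpa using tendsto_const_nhds.add h3
  filter_upwards [h1.eventually_lt_const hp.small] with r hr
  exact ⟨hp.admissible.add (hq.const_smul r), hp.smooth.add (hqs.const_smul r),
    (c1Norm_add_smul_le (hp.smooth.differentiable (by simp)) (hqs.differentiable (by simp))
      r).trans_lt hr⟩

/-- An admissible vector field concentrated near the input state of `X` at `e`. -/
theorem exists_bump (D : G.NodeSpaces) (e : C) (X : D.State) (w : D.P e) {δ : ℝ} (hδ : 0 < δ) :
    ∃ q : D.State → D.State, D.IsAdmissible q ∧ ContDiff ℝ ∞ q ∧ c1Norm q < ⊤ ∧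
      (∀ z e', q z e' ≠ 0 → ∃ β : G.InputIso e e', D.NearState δ X z e e' ∧
        ∀ a : G.Input e, D.NearState δ X z (G.tail a.1) (G.tail (β.toEquiv a).1)) ∧
      (∃ κ : ℝ, 1 ≤ κ ∧ q X e = κ • w) ∧
      ∀ z, ‖q z‖ ≤ (∑ e' : C, Fintype.card (G.InputIso e e')) * ‖w‖ := by
  let b : ContDiffBump ((X e, fun a => X (G.tail a.1)) : D.InputState e) :=
    ⟨δ / 2, δ, by positivity, by linarith⟩
  have hb1 : ∀ v, |b v| ≤ 1 := fun v => by
    rw [abs_of_nonneg b.nonneg]; exact b.le_one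
  have hbc : ContDiff ℝ ∞ b := b.contDiff
  obtain ⟨K, hK⟩ : ∃ K, LipschitzWith K b :=
    hbc.lipschitzWith_of_hasCompactSupport b.hasCompactSupport (by simp)
  obtain ⟨K', hK'⟩ := exists_lipschitzWith_symmetrize e hK w
  refine ⟨D.symmetrize e b w, isAdmissible_symmetrize e b w, contDiff_symmetrize e hbc w,
    c1Norm_lt_top (norm_symmetrize_le e hb1 w) hK', fun z e' h => ?_, ?_,
    norm_symmetrize_le e hb1 w⟩
  · obtain ⟨β, -, hβ⟩ := Finset.exists_ne_zero_of_sum_ne_zero h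
    have h1 : b (D.pullInput β z) ≠ 0 := fun h0 => hβ (by rw [h0, zero_smul])
    have h2 : D.pullInput β z ∈ Function.support b := h1
    rw [b.support_eq] at h2
    exact ⟨β, dist_pullInput_lt β h2⟩
  · refine ⟨∑ β : G.InputIso e e, b (D.pullInput β X), ?_, ?_⟩
    · have h1 : b (D.pullInput (.refl e) X) = 1 := b.one_of_mem_closedBall (by
        rw [pullInput_refl]; exact Metric.mem_closedBall_self (by positivity))
      rw [← h1]
      exact Finset.single_le_sum (f := fun β => b (D.pullInput β X)) (fun _ _ => b.nonneg)
        (Finset.mem_univ _)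
    · rw [Finset.sum_smul]
      rfl

end Network.NodeSpaces

theorem hasDerivAt_profile_family {E : Type*} [NormedAddCommGroup E] [NormedSpace ℝ E]
    {φ : ℝ → C(I, E) × ℝ} {v : C(I, E) × ℝ} {r : ℝ} (h : HasDerivAt φ v r) (τ : ℝ) :
    HasDerivAt (fun ε => profile (φ ε).1 τ) (profile v.1 τ) r :=
  ((ContinuousMap.evalCLM ℝ (⟨Int.fract τ, Int.fract_nonneg τ, (Int.fract_lt_one τ).le⟩ : I)).comp
    (ContinuousLinearMap.fst ℝ C(I, E) ℝ)).hasFDerivAt.comp_hasDerivAt r h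

namespace Network.NodeSpaces

variable {C A : Type*} {G : Network C A}

/-- The data fixed while perturbing a periodic orbit: the vector field, the section, bounds for the
perturbation of the vector field and of the orbit (in rescaled time), the phase shift, and the open
set of times of interest. -/
structure PerturbationSetup (D : G.NodeSpaces) [Fintype C] where
  f : D.State → D.State
  admissible : D.IsAdmissible f
  smooth : ContDiff ℝ ∞ f
  functional : D.State →L[ℝ] ℝ
  level : ℝ
  size : ℝ
  base : C(I, D.State) × ℝ
  radius : ℝ
  phase : ℝ
  start : ℝ
  times : Set ℝ
  isOpen_times : IsOpen times

namespace PerturbationSetup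

variable [Fintype C] {D : G.NodeSpaces} (𝒮 : D.PerturbationSetup)

/-- `u` is a perturbed orbit of `f + p` in rescaled time. -/
structure IsOrbit (p : D.State → D.State) (u : C(I, D.State) × ℝ) : Prop where
  perturbation : D.IsPerturbation p 𝒮.size
  zero : ∃ g : C(D.State, D.State), ⇑g = 𝒮.f + p ∧
    IsNondegenerateZero 𝒮.functional 𝒮.level g u
  close : ‖u - 𝒮.base‖ < 𝒮.radius
  pos : 0 < u.2

variable {𝒮} {p : D.State → D.State} {u : C(I, D.State) × ℝ} {τ : ℝ}

theorem IsOrbit.admissible (h : 𝒮.IsOrbit p u) : D.IsAdmissible (𝒮.f + p) :=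
  𝒮.admissible.add h.perturbation.admissible

theorem IsOrbit.smooth (h : 𝒮.IsOrbit p u) : ContDiff ℝ ∞ (𝒮.f + p) :=
  𝒮.smooth.add h.perturbation.smooth

theorem IsOrbit.hasDerivAt (h : 𝒮.IsOrbit p u) (τ : ℝ) :
    HasDerivAt (profile u.1) (u.2 • (𝒮.f + p) (profile u.1 τ)) τ := by
  obtain ⟨g, hg, hz⟩ := h.zero
  rw [← hg]
  exact hasDerivAt_profile hz.zero τ

theorem IsOrbit.continuous (h : 𝒮.IsOrbit p u) : Continuous (profile u.1) :=
  continuous_iff_continuousAt.2 fun τ => (h.hasDerivAt τ).continuousAt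

theorem IsOrbit.exists_family (h : 𝒮.IsOrbit p u) :
    ∃ K : ℝ, ∀ q : D.State → D.State, D.IsAdmissible q → ContDiff ℝ ∞ q → c1Norm q < ⊤ →
      ∃ (φ : ℝ → C(I, D.State) × ℝ) (v : C(I, D.State) × ℝ), φ 0 = u ∧ HasDerivAt φ v 0 ∧
        (∀ᶠ r in 𝓝 0, 𝒮.IsOrbit (p + r • q) (φ r)) ∧
        ‖v‖ ≤ K * ∫ s in (0:ℝ)..1, ‖q (profile u.1 s)‖ := by
  obtain ⟨g, hg, hz⟩ := h.zero
  have hgs : ContDiff ℝ 1 g := by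
    rw [hg]; exact h.smooth.of_le (by exact_mod_cast le_top)
  obtain ⟨K, hK⟩ := hz.exists_family hgs
  refine ⟨K, fun q hq hqs hqn => ?_⟩
  obtain ⟨φ, v, h0, hev, hd, hv⟩ := hK ⟨q, hqs.continuous⟩
    (hqs.of_le (by exact_mod_cast le_top))
  refine ⟨φ, v, h0, hd, ?_, hv⟩
  have hc : ContinuousAt φ 0 := hd.continuousAt
  have h1 : ∀ᶠ r in 𝓝 0, ‖φ r - 𝒮.base‖ < 𝒮.radius := by
    have : Tendsto (fun r => ‖φ r - 𝒮.base‖) (𝓝 0) (𝓝 ‖φ 0 - 𝒮.base‖) :=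
      (hc.sub continuousAt_const).norm
    exact this.eventually_lt_const (by rw [h0]; exact h.close)
  have h2 : ∀ᶠ r in 𝓝 0, 0 < (φ r).2 := by
    have : Tendsto (fun r => (φ r).2) (𝓝 0) (𝓝 (φ 0).2) := continuousAt_snd.comp hc
    exact this.eventually_const_lt (by rw [h0]; exact h.pos)
  filter_upwards [h.perturbation.eventually_add_smul hq hqs hqn, hev, h1, h2] with r h3 h4 h5 h6
  refine ⟨h3, ⟨_, ?_, h4⟩, h5, h6⟩
  rw [← add_assoc, ← hg]
  rfl

variable (𝒮) in
/-- The state at time `τ`, and the one shifted by the phase. -/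
noncomputable def shifted (u : C(I, D.State) × ℝ) (τ : ℝ) (i : Bool) : D.State :=
  profile u.1 (τ + if i then 𝒮.phase else 0)

variable (𝒮) in
/-- The equalities among the node states at time `τ` and at the shifted time. -/
def syncs (u : C(I, D.State) × ℝ) (τ : ℝ) : Set ((C × Bool) × (C × Bool)) :=
  {k | D.SameState (𝒮.shifted u τ k.1.2) (𝒮.shifted u τ k.2.2) k.1.1 k.2.1}

variable (𝒮) in
/-- The nodes with vanishing velocity at time `τ` and at the shifted time. -/
def rests (p : D.State → D.State) (u : C(I, D.State) × ℝ) (τ : ℝ) : Set (C × Bool) :=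
  {k | (𝒮.f + p) (𝒮.shifted u τ k.2) k.1 = 0}

variable (𝒮) in
/-- The number of coincidences is as small as possible. -/
structure IsGeneric (p : D.State → D.State) (u : C(I, D.State) × ℝ) (τ : ℝ) : Prop where
  isOrbit : 𝒮.IsOrbit p u
  mem_times : 𝒮.start + u.2 * τ ∈ 𝒮.times
  minimal : ∀ p' u' τ', 𝒮.IsOrbit p' u' → 𝒮.start + u'.2 * τ' ∈ 𝒮.times →
    (𝒮.syncs u τ).ncard + (𝒮.rests p u τ).ncard ≤
      (𝒮.syncs u' τ').ncard + (𝒮.rests p' u' τ').ncard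

theorem exists_isGeneric (h : 𝒮.IsOrbit p u) (hτ : 𝒮.start + u.2 * τ ∈ 𝒮.times) :
    ∃ p' u' τ', 𝒮.IsGeneric p' u' τ' := by
  classical
  have hex : ∃ n, ∃ p' u' τ', 𝒮.IsOrbit p' u' ∧ 𝒮.start + u'.2 * τ' ∈ 𝒮.times ∧
    (𝒮.syncs u' τ').ncard + (𝒮.rests p' u' τ').ncard = n := ⟨_, p, u, τ, h, hτ, rfl⟩
  obtain ⟨p', u', τ', h1, h2, h3⟩ := Nat.find_spec hex
  refine ⟨p', u', τ', h1, h2, fun p'' u'' τ'' h4 h5 => ?_⟩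
  rw [h3]
  exact Nat.find_min' hex ⟨p'', u'', τ'', h4, h5, rfl⟩

theorem tendsto_shifted (h : 𝒮.IsOrbit p u) {φ : ℝ → C(I, D.State) × ℝ}
    (h0 : φ 0 = u) (hφ : ContinuousAt φ 0) (τ : ℝ) (i : Bool) :
    Tendsto (fun z : ℝ × ℝ => 𝒮.shifted (φ z.1) z.2 i) (𝓝 (0, τ)) (𝓝 (𝒮.shifted u τ i)) := by
  have h1 : Tendsto (fun z : ℝ × ℝ => 𝒮.shifted u z.2 i) (𝓝 (0, τ)) (𝓝 (𝒮.shifted u τ i)) := by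
    have : Continuous fun z : ℝ × ℝ => 𝒮.shifted u z.2 i :=
      h.continuous.comp (continuous_snd.add continuous_const)
    exact this.tendsto (0, τ)
  have h2 : Tendsto (fun z : ℝ × ℝ => ‖(φ z.1).1 - u.1‖) (𝓝 (0, τ)) (𝓝 0) := by
    have h3 : ContinuousAt (fun z : ℝ × ℝ => φ z.1) (0, τ) :=
      ContinuousAt.comp (f := Prod.fst) (x := ((0 : ℝ), τ)) hφ continuousAt_fst
    have h4 : Tendsto (fun z : ℝ × ℝ => ‖(φ z.1).1 - u.1‖) (𝓝 (0, τ)) (𝓝 ‖(φ 0).1 - u.1‖) :=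
      ((continuousAt_fst.comp h3).sub continuousAt_const).norm
    simpa [h0] using h4
  have h5 : Tendsto (fun z : ℝ × ℝ => 𝒮.shifted (φ z.1) z.2 i - 𝒮.shifted u z.2 i) (𝓝 (0, τ))
      (𝓝 0) := squeeze_zero_norm (fun z => norm_profile_sub_le _ _ _) h2
  simpa using h5.add h1

omit [Fintype C] in
theorem isOpen_not_sameState (e e' : C) :
    IsOpen {z : D.State × D.State | ¬ D.SameState z.1 z.2 e e'} :=
  (isClosed_sameState continuous_fst continuous_snd e e').isOpen_compl

/-- Coincidences are locally constant near a generic point. -/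
theorem IsGeneric.eventually_eq (h : 𝒮.IsGeneric p u τ) {q : D.State → D.State}
    (hq : Continuous q) {φ : ℝ → C(I, D.State) × ℝ} (h0 : φ 0 = u) (hφ : ContinuousAt φ 0)
    (hev : ∀ᶠ r in 𝓝 0, 𝒮.IsOrbit (p + r • q) (φ r)) :
    ∀ᶠ z : ℝ × ℝ in 𝓝 (0, τ), 𝒮.IsGeneric (p + z.1 • q) (φ z.1) z.2 ∧
      𝒮.syncs (φ z.1) z.2 = 𝒮.syncs u τ ∧ 𝒮.rests (p + z.1 • q) (φ z.1) z.2 = 𝒮.rests p u τ := by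
  have h1 : ∀ᶠ z : ℝ × ℝ in 𝓝 (0, τ), 𝒮.IsOrbit (p + z.1 • q) (φ z.1) :=
    (continuousAt_fst (p := ((0 : ℝ), τ))).eventually hev
  have h2 : ∀ᶠ z : ℝ × ℝ in 𝓝 (0, τ), 𝒮.start + (φ z.1).2 * z.2 ∈ 𝒮.times := by
    have h3 : ContinuousAt (fun z : ℝ × ℝ => φ z.1) (0, τ) :=
      ContinuousAt.comp (f := Prod.fst) (x := ((0 : ℝ), τ)) hφ continuousAt_fst
    have h4 : ContinuousAt (fun z : ℝ × ℝ => 𝒮.start + (φ z.1).2 * z.2) (0, τ) :=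
      continuousAt_const.add ((continuousAt_snd.comp h3).mul continuousAt_snd)
    exact h4.eventually (𝒮.isOpen_times.mem_nhds (by simpa [h0] using h.mem_times))
  have h3 : ∀ k, k ∉ 𝒮.syncs u τ → ∀ᶠ z : ℝ × ℝ in 𝓝 (0, τ), k ∉ 𝒮.syncs (φ z.1) z.2 := by
    intro k hk
    have := (tendsto_shifted h.isOrbit h0 hφ τ k.1.2).prodMk_nhds
      (tendsto_shifted h.isOrbit h0 hφ τ k.2.2)
    exact this.eventually ((isOpen_not_sameState k.1.1 k.2.1).mem_nhds hk)
  have h4 : ∀ k, k ∉ 𝒮.rests p u τ →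
      ∀ᶠ z : ℝ × ℝ in 𝓝 (0, τ), k ∉ 𝒮.rests (p + z.1 • q) (φ z.1) z.2 := by
    intro k hk
    have hZ := tendsto_shifted h.isOrbit h0 hφ τ k.2
    have ha : Tendsto (fun z : ℝ × ℝ => (𝒮.f + p) (𝒮.shifted (φ z.1) z.2 k.2) k.1) (𝓝 (0, τ))
        (𝓝 ((𝒮.f + p) (𝒮.shifted u τ k.2) k.1)) :=
      (((continuous_apply k.1).comp h.isOrbit.smooth.continuous).tendsto _).comp hZ
    have hb : Tendsto (fun z : ℝ × ℝ => z.1 • q (𝒮.shifted (φ z.1) z.2 k.2) k.1) (𝓝 (0, τ))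
        (𝓝 ((0 : ℝ) • q (𝒮.shifted u τ k.2) k.1)) :=
      (continuous_fst.tendsto _).smul ((((continuous_apply k.1).comp hq).tendsto _).comp hZ)
    have hc := ha.add hb
    rw [zero_smul, add_zero] at hc
    filter_upwards [hc.eventually_ne hk] with z hz hz'
    refine hz ?_
    rw [← show (𝒮.f + (p + z.1 • q)) (𝒮.shifted (φ z.1) z.2 k.2) k.1 = 0 from hz']
    simp [add_assoc]
  have h3' : ∀ᶠ z : ℝ × ℝ in 𝓝 (0, τ), ∀ k, k ∉ 𝒮.syncs u τ → k ∉ 𝒮.syncs (φ z.1) z.2 :=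
    eventually_all.2 fun k => by
      by_cases hk : k ∈ 𝒮.syncs u τ
      · exact Eventually.of_forall fun _ h => (h hk).elim
      · exact (h3 k hk).mono fun _ hz _ => hz
  have h4' : ∀ᶠ z : ℝ × ℝ in 𝓝 (0, τ), ∀ k, k ∉ 𝒮.rests p u τ →
      k ∉ 𝒮.rests (p + z.1 • q) (φ z.1) z.2 :=
    eventually_all.2 fun k => by
      by_cases hk : k ∈ 𝒮.rests p u τ
      · exact Eventually.of_forall fun _ h => (h hk).elim
      · exact (h4 k hk).mono fun _ hz _ => hz
  filter_upwards [h1, h2, h3', h4'] with z hz1 hz2 hz3 hz4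
  have s1 : 𝒮.syncs (φ z.1) z.2 ⊆ 𝒮.syncs u τ := fun k hk => by
    by_contra hn; exact hz3 k hn hk
  have s2 : 𝒮.rests (p + z.1 • q) (φ z.1) z.2 ⊆ 𝒮.rests p u τ := fun k hk => by
    by_contra hn; exact hz4 k hn hk
  have n1 := ncard_le_ncard s1 (toFinite _)
  have n2 := ncard_le_ncard s2 (toFinite _)
  have n3 := h.minimal _ _ _ hz1 hz2
  refine ⟨⟨hz1, hz2, fun p' u' τ' h1 h2 => ?_⟩, eq_of_subset_of_ncard_le s1 (by omega) (toFinite _),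
    eq_of_subset_of_ncard_le s2 (by omega) (toFinite _)⟩
  have := h.minimal p' u' τ' h1 h2
  omega

theorem IsGeneric.eventually_isGeneric (h : 𝒮.IsGeneric p u τ) :
    ∀ᶠ t in 𝓝 τ, 𝒮.IsGeneric p u t ∧ 𝒮.syncs u t = 𝒮.syncs u τ ∧
      𝒮.rests p u t = 𝒮.rests p u τ := by
  have h1 := h.eventually_eq (q := 0) continuous_zero (φ := fun _ => u) rfl continuousAt_const
    (Eventually.of_forall fun r => by simpa using h.isOrbit)
  have h2 : Tendsto (fun t : ℝ => ((0 : ℝ), t)) (𝓝 τ) (𝓝 (0, τ)) :=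
    (Continuous.prodMk_right (0 : ℝ)).tendsto τ
  filter_upwards [h2.eventually h1] with t ht
  simpa using ht

/-- The first variation of the velocity field along a family of perturbed orbits. -/
theorem hasDerivAt_velocity (h : 𝒮.IsOrbit p u) {q : D.State → D.State} (hq : ContDiff ℝ ∞ q)
    {φ : ℝ → C(I, D.State) × ℝ} {v : C(I, D.State) × ℝ} (h0 : φ 0 = u) (hφ : HasDerivAt φ v 0)
    (t : ℝ) (i : Bool) :
    HasDerivAt (fun r => (𝒮.f + (p + r • q)) (𝒮.shifted (φ r) t i))
      (fderiv ℝ (𝒮.f + p) (𝒮.shifted u t i) (𝒮.shifted v t i) + q (𝒮.shifted u t i)) 0 := by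
  have hZ : HasDerivAt (fun r => 𝒮.shifted (φ r) t i) (𝒮.shifted v t i) 0 :=
    hasDerivAt_profile_family hφ _
  have h00 : 𝒮.shifted (φ 0) t i = 𝒮.shifted u t i := by rw [h0]
  have h1 : HasDerivAt (fun r => (𝒮.f + p) (𝒮.shifted (φ r) t i))
      (fderiv ℝ (𝒮.f + p) (𝒮.shifted u t i) (𝒮.shifted v t i)) 0 := by
    have := (h.smooth.differentiable (by simp) (𝒮.shifted (φ 0) t i)).hasFDerivAt.comp_hasDerivAt
      (0 : ℝ) hZ
    rwa [h00] at this
  have h2 : HasDerivAt (fun r => q (𝒮.shifted (φ r) t i))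
      (fderiv ℝ q (𝒮.shifted u t i) (𝒮.shifted v t i)) 0 := by
    have := (hq.differentiable (by simp) (𝒮.shifted (φ 0) t i)).hasFDerivAt.comp_hasDerivAt
      (0 : ℝ) hZ
    rwa [h00] at this
  have h3 := h1.add ((hasDerivAt_id (0 : ℝ)).smul h2)
  have e1 : (fun r => (𝒮.f + (p + r • q)) (𝒮.shifted (φ r) t i)) =
      (fun r => (𝒮.f + p) (𝒮.shifted (φ r) t i)) +
        (id : ℝ → ℝ) • fun r => q (𝒮.shifted (φ r) t i) := by
    ext r : 1
    simp [add_assoc]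
  have e2 : fderiv ℝ (𝒮.f + p) (𝒮.shifted u t i) (𝒮.shifted v t i) + q (𝒮.shifted u t i) =
      fderiv ℝ (𝒮.f + p) (𝒮.shifted u t i) (𝒮.shifted v t i) +
        ((id 0 : ℝ) • fderiv ℝ q (𝒮.shifted u t i) (𝒮.shifted v t i) +
          (1 : ℝ) • q (𝒮.shifted (φ 0) t i)) := by
    rw [h00, id, zero_smul, one_smul, zero_add]
  rw [e1, e2]
  exact h3

theorem hasDerivAt_shifted (h : 𝒮.IsOrbit p u) (t : ℝ) (i : Bool) :
    HasDerivAt (fun s => 𝒮.shifted u s i) (u.2 • (𝒮.f + p) (𝒮.shifted u t i)) t :=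
  (h.hasDerivAt _).comp_add_const t _

/-- The linearized consequences of genericity. -/
theorem IsGeneric.variation (h : 𝒮.IsGeneric p u τ) {q : D.State → D.State}
    (hq : ContDiff ℝ ∞ q) {φ : ℝ → C(I, D.State) × ℝ} {v : C(I, D.State) × ℝ} (h0 : φ 0 = u)
    (hφ : HasDerivAt φ v 0) (hev : ∀ᶠ r in 𝓝 0, 𝒮.IsOrbit (p + r • q) (φ r)) :
    (∀ k ∈ 𝒮.syncs u τ, D.SameState (𝒮.shifted v τ k.1.2) (𝒮.shifted v τ k.2.2) k.1.1 k.2.1 ∧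
      D.SameState
        (fderiv ℝ (𝒮.f + p) (𝒮.shifted u τ k.1.2) (𝒮.shifted v τ k.1.2) + q (𝒮.shifted u τ k.1.2))
        (fderiv ℝ (𝒮.f + p) (𝒮.shifted u τ k.2.2) (𝒮.shifted v τ k.2.2) + q (𝒮.shifted u τ k.2.2))
        k.1.1 k.2.1) ∧
    ∀ k ∈ 𝒮.rests p u τ,
      (fderiv ℝ (𝒮.f + p) (𝒮.shifted u τ k.2) (𝒮.shifted v τ k.2) +
        q (𝒮.shifted u τ k.2)) k.1 = 0 := by
  have hloc := h.eventually_eq hq.continuous h0 hφ.continuousAt hev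
  rw [nhds_prod_eq] at hloc
  have hloc' := hloc.curry
  refine ⟨fun k hk => ⟨?_, ?_⟩, fun k hk => ?_⟩
  · refine SameState.of_hasDerivAt (hasDerivAt_profile_family hφ _)
      (hasDerivAt_profile_family hφ _) ?_
    filter_upwards [hloc'] with r hr
    obtain ⟨-, h1, -⟩ := hr.self_of_nhds
    rw [← h1] at hk
    exact hk
  · refine SameState.of_hasDerivAt (hasDerivAt_velocity h.isOrbit hq h0 hφ τ _)
      (hasDerivAt_velocity h.isOrbit hq h0 hφ τ _) ?_
    filter_upwards [hloc', hev] with r hr hor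
    have h1 : ∀ᶠ s in 𝓝 τ, D.SameState (𝒮.shifted (φ r) s k.1.2) (𝒮.shifted (φ r) s k.2.2)
        k.1.1 k.2.1 := by
      filter_upwards [hr] with s hs
      rw [← hs.2.1] at hk
      exact hk
    have h2 := SameState.of_hasDerivAt (hasDerivAt_shifted hor τ k.1.2)
      (hasDerivAt_shifted hor τ k.2.2) h1
    have h3 := h2.smul ((φ r).2)⁻¹
    rwa [inv_smul_smul₀ hor.pos.ne', inv_smul_smul₀ hor.pos.ne'] at h3
  · have h1 := hasDerivAt_pi.1 (hasDerivAt_velocity h.isOrbit hq h0 hφ τ k.2) k.1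
    refine h1.unique ((hasDerivAt_const (0 : ℝ) (0 : D.P k.1)).congr_of_eventuallyEq ?_)
    filter_upwards [hloc'] with r hr
    obtain ⟨-, -, h2⟩ := hr.self_of_nhds
    rw [← h2] at hk
    exact hk

end PerturbationSetup
end Network.NodeSpaces

namespace Network.NodeSpaces

variable {C A : Type*} {G : Network C A} {D : G.NodeSpaces}

theorem InputSync.refl (z : D.State) (e : C) : D.InputSync z z e e :=
  ⟨.refl e, .refl z e, fun a => .refl z (G.tail a.1)⟩

theorem InputSync.symm {z y : D.State} {e e' : C} (h : D.InputSync z y e e') :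
    D.InputSync y z e' e := by
  obtain ⟨β, h1, h2⟩ := h
  refine ⟨β.symm, h1.symm, fun a => ?_⟩
  have := (h2 (β.toEquiv.symm a)).symm
  rwa [Equiv.apply_symm_apply] at this

theorem InputSync.trans {z y x : D.State} {e e' e'' : C} (h : D.InputSync z y e e')
    (h' : D.InputSync y x e' e'') : D.InputSync z x e e'' := by
  obtain ⟨β, h1, h2⟩ := h
  obtain ⟨γ, h3, h4⟩ := h'
  exact ⟨β.trans γ, h1.trans h3, fun a => (h2 a).trans (h4 _)⟩

theorem eventually_not_nearState {X z : D.State} {e e' : C} (h : ¬ D.SameState X z e e')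
    {δ : ℕ → ℝ} (hδ : Tendsto δ atTop (𝓝 0)) : ∀ᶠ n in atTop, ¬ D.NearState (δ n) X z e e' := by
  by_cases hd : D.dim e = D.dim e'
  · have : 0 < dist (transport hd (X e)) (z e') := dist_pos.2 fun h' => h ⟨hd, h'⟩
    filter_upwards [hδ.eventually_lt_const this] with n hn h'
    obtain ⟨_, h'⟩ := h'
    exact (h'.trans hn).false
  · exact Eventually.of_forall fun n h' => hd h'.1

theorem eventually_inputSync [Finite C] [Finite A] (X z : D.State) (e : C) {δ : ℕ → ℝ}
    (hδ : Tendsto δ atTop (𝓝 0)) :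
    ∀ᶠ n in atTop, ∀ e', (∃ β : G.InputIso e e', D.NearState (δ n) X z e e' ∧
      ∀ a : G.Input e, D.NearState (δ n) X z (G.tail a.1) (G.tail (β.toEquiv a).1)) →
        D.InputSync X z e e' := by
  have h1 : ∀ e', ∀ β : G.InputIso e e', ∀ᶠ n in atTop, (D.NearState (δ n) X z e e' ∧
      ∀ a : G.Input e, D.NearState (δ n) X z (G.tail a.1) (G.tail (β.toEquiv a).1)) →
        D.InputSync X z e e' := by
    intro e' β
    by_cases h : D.InputSync X z e e'
    · exact Eventually.of_forall fun _ _ => h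
    by_cases he : D.SameState X z e e'
    · obtain ⟨a, ha⟩ : ∃ a : G.Input e, ¬ D.SameState X z (G.tail a.1)
          (G.tail (β.toEquiv a).1) := by
        by_contra! hn
        exact h ⟨β, he, hn⟩
      filter_upwards [eventually_not_nearState ha hδ] with n hn hn'
      exact (hn (hn'.2 a)).elim
    · filter_upwards [eventually_not_nearState he hδ] with n hn hn'
      exact (hn hn'.1).elim
  have h2 : ∀ᶠ n in atTop, ∀ e', ∀ β : G.InputIso e e', (D.NearState (δ n) X z e e' ∧
      ∀ a : G.Input e, D.NearState (δ n) X z (G.tail a.1) (G.tail (β.toEquiv a).1)) →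
        D.InputSync X z e e' :=
    eventually_all.2 fun e' => eventually_all.2 fun β => h1 e' β
  filter_upwards [h2] with n hn e' h
  obtain ⟨β, hβ⟩ := h
  exact hn e' β hβ

theorem exists_ne_zero (D : G.NodeSpaces) (e : C) : ∃ w : D.P e, w ≠ 0 := by
  have : Nonempty (Fin (D.dim e)) := ⟨⟨0, D.dim_pos e⟩⟩
  exact exists_ne 0

namespace PerturbationSetup

variable [Fintype C] {𝒮 : D.PerturbationSetup} {p : D.State → D.State}
  {u : C(I, D.State) × ℝ} {τ : ℝ}

theorem norm_shifted_le (v : C(I, D.State) × ℝ) (t : ℝ) (i : Bool) :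
    ‖𝒮.shifted v t i‖ ≤ ‖v‖ :=
  (v.1.norm_coe_le_norm _).trans (norm_fst_le v)

/-- A moving node state passes through values that are not held for a positive time. -/
theorem IsGeneric.exists_null_time (h : 𝒮.IsGeneric p u τ) {b : C} {i : Bool}
    (hb : (b, i) ∉ 𝒮.rests p u τ) :
    ∃ t, 𝒮.IsGeneric p u t ∧ 𝒮.syncs u t = 𝒮.syncs u τ ∧ 𝒮.rests p u t = 𝒮.rests p u τ ∧
      ∀ᵐ s, ∀ b', ¬ D.SameState (𝒮.shifted u t i) (profile u.1 s) b b' := by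
  have hc := h.isOrbit.continuous
  let bad : Set (D.P b) := ⋃ (b' : C), ⋃ (hd : D.dim b = D.dim b'),
    {y | 0 < volume {s | transport hd.symm (profile u.1 s b') = y}}
  have hbad : bad.Countable := by
    refine countable_iUnion fun b' => countable_iUnion fun hd => ?_
    refine Measure.countable_meas_level_set_pos ?_
    have : Continuous fun s => transportL hd.symm (profile u.1 s b') := by fun_prop
    exact this.measurable
  obtain ⟨r, hr, hball⟩ := Metric.eventually_nhds_iff_ball.1 h.eventually_isGeneric
  have hder := hasDerivAt_pi.1 (hasDerivAt_shifted h.isOrbit τ i) b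
  have hconn : IsPreconnected ((fun t => 𝒮.shifted u t i b) '' Metric.ball τ r) := by
    refine (Real.ball_eq_Ioo τ r ▸ isPreconnected_Ioo).image _ (Continuous.continuousOn ?_)
    exact (continuous_apply b).comp (hc.comp (by fun_prop))
  obtain ⟨t, ht, htbad⟩ : ∃ t ∈ Metric.ball τ r, 𝒮.shifted u t i b ∉ bad := by
    by_contra! hcon
    have hsub : (fun t => 𝒮.shifted u t i b) '' Metric.ball τ r ⊆ bad := by
      rintro _ ⟨t, ht, rfl⟩; exact hcon t ht
    have hss := (hbad.mono hsub).isTotallyDisconnected _ subset_rfl hconn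
    refine hb ?_
    have hconst : HasDerivAt (fun t => 𝒮.shifted u t i b) (0 : D.P b) τ := by
      refine (hasDerivAt_const τ (𝒮.shifted u τ i b)).congr_of_eventuallyEq ?_
      filter_upwards [Metric.ball_mem_nhds τ hr] with t ht
      exact hss ⟨t, ht, rfl⟩ ⟨τ, Metric.mem_ball_self hr, rfl⟩
    have h0 := hder.unique hconst
    rw [Pi.smul_apply, smul_eq_zero] at h0
    exact h0.resolve_left h.isOrbit.pos.ne'
  obtain ⟨h1, h2, h3⟩ := hball t ht
  refine ⟨t, h1, h2, h3, ae_all_iff.2 fun b' => ?_⟩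
  by_cases hd : D.dim b = D.dim b'
  · have h4 : volume {s | transport hd.symm (profile u.1 s b') = 𝒮.shifted u t i b} = 0 := by
      by_contra hne
      exact htbad (mem_iUnion₂.2 ⟨b', hd, pos_iff_ne_zero.2 hne⟩)
    rw [ae_iff]
    refine measure_mono_null (fun s hs => ?_) h4
    simp only [not_not, mem_ofPred_eq] at hs ⊢
    obtain ⟨hd', hs⟩ := hs
    rw [← hs]; simp
  · exact Eventually.of_forall fun s hs => hd hs.1

variable [Fintype A]

/-- Perturbations localized near the input state of a node at a given time. -/
theorem IsOrbit.exists_localized (h : 𝒮.IsOrbit p u) (τ : ℝ) (e : C) (i : Bool) (w : D.P e) :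
    ∃ (q : ℕ → D.State → D.State) (φ : ℕ → ℝ → C(I, D.State) × ℝ) (v : ℕ → C(I, D.State) × ℝ),
      (∀ n, D.IsAdmissible (q n) ∧ ContDiff ℝ ∞ (q n) ∧ φ n 0 = u ∧ HasDerivAt (φ n) (v n) 0 ∧
        ∀ᶠ r in 𝓝 0, 𝒮.IsOrbit (p + r • q n) (φ n r)) ∧
      (∀ n, ∃ κ : ℝ, 1 ≤ κ ∧ q n (𝒮.shifted u τ i) e = κ • w) ∧
      (∀ z, ∀ᶠ n in atTop, ∀ e', q n z e' ≠ 0 → D.InputSync (𝒮.shifted u τ i) z e e') ∧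
      ((∀ᵐ s, ∀ e', ¬ D.InputSync (𝒮.shifted u τ i) (profile u.1 s) e e') →
        Tendsto v atTop (𝓝 0)) := by
  obtain ⟨K, hK⟩ := h.exists_family
  let δ : ℕ → ℝ := fun n => 1 / ((n : ℝ) + 1)
  have hδ : Tendsto δ atTop (𝓝 0) := tendsto_one_div_add_atTop_nhds_zero_nat
  have hδ0 : ∀ n, 0 < δ n := fun n => by positivity
  choose q hq1 hq2 hq3 hq4 hq5 hq6 using fun n => D.exists_bump e (𝒮.shifted u τ i) w (hδ0 n)
  choose φ v hφ0 hφ hφo hv using fun n => hK (q n) (hq1 n) (hq2 n) (hq3 n)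
  have hloc : ∀ z, ∀ᶠ n in atTop, ∀ e', q n z e' ≠ 0 →
      D.InputSync (𝒮.shifted u τ i) z e e' := by
    intro z
    filter_upwards [eventually_inputSync (𝒮.shifted u τ i) z e hδ] with n hn e' he'
    exact hn e' (hq4 n z e' he')
  refine ⟨q, φ, v, fun n => ⟨hq1 n, hq2 n, hφ0 n, hφ n, hφo n⟩, hq5, hloc, fun hae => ?_⟩
  have hint : Tendsto (fun n => ∫ s in (0:ℝ)..1, ‖q n (profile u.1 s)‖) atTop
      (𝓝 (∫ _ in (0:ℝ)..1, (0 : ℝ))) := by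
    refine intervalIntegral.tendsto_integral_filter_of_dominated_convergence
      (fun _ => (∑ e' : C, Fintype.card (G.InputIso e e')) * ‖w‖)
      (Eventually.of_forall fun n => ?_) (Eventually.of_forall fun n => ?_)
      intervalIntegrable_const ?_
    · exact ((hq2 n).continuous.comp h.continuous).norm.aestronglyMeasurable
    · exact Eventually.of_forall fun s _ => by
        rw [norm_norm]
        exact hq6 n _
    · filter_upwards [hae] with s hs _
      refine tendsto_const_nhds.congr' ?_
      filter_upwards [hloc (profile u.1 s)] with n hn
      rw [eq_comm, norm_eq_zero]
      ext1 e'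
      by_contra hne
      exact hs e' (hn e' hne)
  rw [intervalIntegral.integral_zero] at hint
  have h2 := hint.const_mul K
  rw [mul_zero] at h2
  exact squeeze_zero_norm hv h2

/-- The balance condition at a node that is not, with all its inputs, at rest. -/
theorem IsGeneric.inputSync_of_moving (h : 𝒮.IsGeneric p u τ) {e b : C} {i : Bool}
    (hb : b = e ∨ ∃ a : G.Input e, b = G.tail a.1) (hbi : (b, i) ∉ 𝒮.rests p u τ) :
    (e, i) ∉ 𝒮.rests p u τ ∧ ∀ e' j, ((e, i), (e', j)) ∈ 𝒮.syncs u τ →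
      D.InputSync (𝒮.shifted u τ i) (𝒮.shifted u τ j) e e' := by
  obtain ⟨t, ht, hsync, hrest, hnull⟩ := h.exists_null_time hbi
  obtain ⟨w, hw⟩ := D.exists_ne_zero e
  obtain ⟨q, φ, v, hqφ, hκ, hloc, hv⟩ := ht.isOrbit.exists_localized t e i w
  have hv0 : Tendsto v atTop (𝓝 0) := by
    refine hv ?_
    filter_upwards [hnull] with s hs e' hsyn
    obtain ⟨β, h1, h2⟩ := hsyn
    rcases hb with rfl | ⟨a, rfl⟩
    · exact hs _ h1
    · exact hs _ (h2 a)
  have hD : ∀ (j : Bool) (e' : C), Tendsto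
      (fun n => ‖fderiv ℝ (𝒮.f + p) (𝒮.shifted u t j) (𝒮.shifted (v n) t j) e'‖) atTop (𝓝 0) := by
    intro j e'
    have h1 : Tendsto (fun n => 𝒮.shifted (v n) t j) atTop (𝓝 0) :=
      squeeze_zero_norm (fun n => norm_shifted_le _ _ _) (by simpa using hv0.norm)
    have h2 := (((continuous_apply e').comp
      (fderiv ℝ (𝒮.f + p) (𝒮.shifted u t j)).continuous).norm.tendsto 0).comp h1
    simpa [Function.comp_def] using h2
  have hwpos : 0 < ‖w‖ := norm_pos_iff.2 hw
  have hκ' : ∀ n, ‖w‖ ≤ ‖q n (𝒮.shifted u t i) e‖ := by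
    intro n
    obtain ⟨κ, h1, h2⟩ := hκ n
    rw [h2, norm_smul, Real.norm_eq_abs, abs_of_pos (by linarith)]
    exact le_mul_of_one_le_left hwpos.le h1
  have hvar := fun n => ht.variation (hqφ n).2.1 (hqφ n).2.2.1 (hqφ n).2.2.2.1 (hqφ n).2.2.2.2
  constructor
  · intro hmem
    rw [← hrest] at hmem
    obtain ⟨n, hn⟩ := ((hD i e).eventually_lt_const hwpos).exists
    have h1 := (hvar n).2 _ hmem
    rw [Pi.add_apply, add_eq_zero_iff_eq_neg] at h1
    rw [h1, norm_neg] at hn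
    exact absurd (hκ' n) (not_le.2 hn)
  · intro e' j hmem
    have key : D.InputSync (𝒮.shifted u t i) (𝒮.shifted u t j) e e' := by
      by_contra hns
      rw [← hsync] at hmem
      obtain ⟨n, hn1, hn2, hn3⟩ := (((hD i e).eventually_lt_const (half_pos hwpos)).and
        (((hD j e').eventually_lt_const (half_pos hwpos)).and
          (hloc (𝒮.shifted u t j)))).exists
      have hq0 : q n (𝒮.shifted u t j) e' = 0 := by
        by_contra hne
        exact hns (hn3 e' hne)
      have h1 := ((hvar n).1 _ hmem).2.norm_eq
      simp only [Pi.add_apply, hq0, add_zero] at h1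
      have h2 := norm_sub_norm_le (q n (𝒮.shifted u t i) e)
        (-(fderiv ℝ (𝒮.f + p) (𝒮.shifted u t i) (𝒮.shifted (v n) t i) e))
      rw [norm_neg, sub_neg_eq_add, add_comm (q n _ e), h1] at h2
      have := hκ' n
      linarith
    obtain ⟨β, h1, h2⟩ := key
    have tr : ∀ k, k ∈ 𝒮.syncs u t → k ∈ 𝒮.syncs u τ := fun k hk => hsync ▸ hk
    exact ⟨β, tr ((e, i), (e', j)) h1, fun a =>
      tr ((G.tail a.1, i), (G.tail (β.toEquiv a).1, j)) (h2 a)⟩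

end PerturbationSetup
end Network.NodeSpaces

namespace Network.NodeSpaces

variable {C A : Type*} {G : Network C A} {D : G.NodeSpaces}

open Classical in
/-- The projection setting to zero all node states outside `s`. -/
noncomputable def cutoff (D : G.NodeSpaces) (s : Set C) : D.State →L[ℝ] D.State :=
  .pi fun e => if e ∈ s then .proj e else 0

theorem cutoff_of_mem {s : Set C} {e : C} (he : e ∈ s) (z : D.State) : D.cutoff s z e = z e := by
  simp [cutoff, he]

theorem cutoff_of_notMem {s : Set C} {e : C} (he : e ∉ s) (z : D.State) : D.cutoff s z e = 0 := by
  simp [cutoff, he]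

theorem cutoff_cutoff (s : Set C) (z : D.State) : D.cutoff s (D.cutoff s z) = D.cutoff s z := by
  ext1 e
  by_cases he : e ∈ s
  · rw [cutoff_of_mem he]
  · rw [cutoff_of_notMem he, cutoff_of_notMem he]

theorem IsAdmissible.cutoff {f : D.State → D.State} (hf : D.IsAdmissible f) {s : Set C} {e : C}
    (he : e ∈ s) (ha : ∀ a : G.Input e, G.tail a.1 ∈ s) (z : D.State) :
    f (D.cutoff s z) e = f z e :=
  (hf.sameState (.refl e) (z := D.cutoff s z) (y := z) ⟨rfl, cutoff_of_mem he z⟩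
    fun a => ⟨rfl, cutoff_of_mem (ha a) z⟩).2

theorem IsAdmissible.fderiv_cutoff [Fintype C] {f : D.State → D.State} (hf : D.IsAdmissible f)
    (hd : Differentiable ℝ f) {s : Set C} {e : C} (he : e ∈ s)
    (ha : ∀ a : G.Input e, G.tail a.1 ∈ s) (z v : D.State) :
    fderiv ℝ f (D.cutoff s z) (D.cutoff s v) e = fderiv ℝ f z v e := by
  have h1 : HasFDerivAt (fun y => f (D.cutoff s y) e) _ z :=
    (hasFDerivAt_pi'.1 (hd (D.cutoff s z)).hasFDerivAt e).comp z (D.cutoff s).hasFDerivAt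
  have h2 : HasFDerivAt (fun y => f y e) _ z := hasFDerivAt_pi'.1 (hd z).hasFDerivAt e
  simp only [hf.cutoff he ha] at h1
  exact congrArg (fun L => L v) (h1.unique h2)

variable {ι : Type*}

/-- The families of states vanishing outside `s` and synchronous along the relation `R` in `s`. -/
def syncSubspace (D : G.NodeSpaces) (s : Set (C × ι)) (R : C × ι → C × ι → Prop) :
    Submodule ℝ (ι → D.State) where
  carrier := {v | (∀ k, k ∉ s → v k.2 k.1 = 0) ∧ ∀ k ∈ s, ∀ l ∈ s, R k l →
    ∀ h : D.dim k.1 = D.dim l.1, transport h (v k.2 k.1) = v l.2 l.1}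
  add_mem' {v w} hv hw := by
    refine ⟨fun k hk => ?_, fun k hk l hl hR h => ?_⟩
    · rw [Pi.add_apply, Pi.add_apply, hv.1 k hk, hw.1 k hk, add_zero]
    · rw [Pi.add_apply, Pi.add_apply, Pi.add_apply, Pi.add_apply, transport_add,
        hv.2 k hk l hl hR h, hw.2 k hk l hl hR h]
  zero_mem' := ⟨fun _ _ => rfl, fun _ _ _ _ _ _ => rfl⟩
  smul_mem' r v hv := by
    refine ⟨fun k hk => ?_, fun k hk l hl hR h => ?_⟩
    · rw [Pi.smul_apply, Pi.smul_apply, hv.1 k hk, smul_zero]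
    · rw [Pi.smul_apply, Pi.smul_apply, Pi.smul_apply, Pi.smul_apply, transport_smul,
        hv.2 k hk l hl hR h]

open Classical in
/-- The family of states equal to `w` on the input-synchrony class of `k`. -/
noncomputable def classVector (D : G.NodeSpaces) (z : ι → D.State) (k : C × ι) (w : D.P k.1) :
    ι → D.State :=
  fun j e => if h : D.InputSync (z k.2) (z j) k.1 e then
    transport (by obtain ⟨β, _⟩ := h; exact D.dim_node β) w else 0

theorem classVector_of_inputSync {z : ι → D.State} {k l : C × ι} {w : D.P k.1}
    (h : D.InputSync (z k.2) (z l.2) k.1 l.1) (hd : D.dim k.1 = D.dim l.1) :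
    D.classVector z k w l.2 l.1 = transport hd w := by
  rw [classVector, dif_pos h]

theorem classVector_of_not_inputSync {z : ι → D.State} {k l : C × ι} {w : D.P k.1}
    (h : ¬ D.InputSync (z k.2) (z l.2) k.1 l.1) :
    D.classVector z k w l.2 l.1 = 0 := by
  rw [classVector, dif_neg h]

theorem InputSync.dim_eq {z y : D.State} {e e' : C} (h : D.InputSync z y e e') :
    D.dim e = D.dim e' := by
  obtain ⟨β, _⟩ := h
  exact D.dim_node β

theorem mem_of_classVector_mem [Finite C] [Finite ι] {z : ι → D.State} {s : Set (C × ι)}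
    {W : Submodule ℝ (ι → D.State)}
    (hW : ∀ k ∈ s, ∀ w, D.classVector z k w ∈ W)
    (hs : ∀ k ∈ s, ∀ l : C × ι, D.InputSync (z k.2) (z l.2) k.1 l.1 → l ∈ s) :
    D.syncSubspace s (fun k l => D.InputSync (z k.2) (z l.2) k.1 l.1) ≤ W := by
  classical
  intro v hv
  let S : Setoid s :=
    { r := fun k l => D.InputSync (z k.1.2) (z l.1.2) k.1.1 l.1.1
      iseqv := ⟨fun k => .refl _ _, fun h => h.symm, fun h h' => h.trans h'⟩ }
  have : Fintype (Quotient S) := Fintype.ofFinite _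
  have key : v = ∑ c : Quotient S, D.classVector z c.out.1 (v c.out.1.2 c.out.1.1) := by
    ext1 j
    ext1 e
    rw [Finset.sum_apply, Finset.sum_apply]
    by_cases hm : (e, j) ∈ s
    · let k : s := ⟨(e, j), hm⟩
      have hout : D.InputSync (z (Quotient.mk S k).out.1.2) (z j) (Quotient.mk S k).out.1.1 e :=
        Quotient.mk_out (s := S) k
      rw [Finset.sum_eq_single (Quotient.mk S k)]
      · rw [classVector_of_inputSync (l := (e, j)) hout hout.dim_eq]
        exact (hv.2 _ (Quotient.mk S k).out.2 (e, j) hm hout _).symm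
      · intro c _ hc
        refine classVector_of_not_inputSync (l := (e, j)) fun h => hc ?_
        have h' : S c.out k := h
        rw [← Quotient.sound (s := S) h', Quotient.out_eq]
      · exact fun h => (h (Finset.mem_univ _)).elim
    · rw [hv.1 (e, j) hm]
      refine (Finset.sum_eq_zero fun c _ => ?_).symm
      exact classVector_of_not_inputSync (l := (e, j)) fun h => hm (hs _ c.out.2 (e, j) h)
  rw [key]
  exact W.sum_mem fun c _ => hW _ c.out.2 _

theorem classVector_mem_syncSubspace {z : ι → D.State} {s : Set (C × ι)}
    (hs : ∀ k ∈ s, ∀ l : C × ι, D.InputSync (z k.2) (z l.2) k.1 l.1 → l ∈ s) {k : C × ι}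
    (hk : k ∈ s) (w : D.P k.1) : D.classVector z k w ∈
      D.syncSubspace s (fun k l => D.InputSync (z k.2) (z l.2) k.1 l.1) := by
  refine ⟨fun l hl => classVector_of_not_inputSync fun h => hl (hs k hk l h),
    fun l hl m hm h hd => ?_⟩
  by_cases hkl : D.InputSync (z k.2) (z l.2) k.1 l.1
  · have hkm := hkl.trans h
    rw [classVector_of_inputSync hkl hkl.dim_eq, classVector_of_inputSync hkm hkm.dim_eq]
    simp
  · have hkm : ¬ D.InputSync (z k.2) (z m.2) k.1 m.1 := fun h' => hkl (h'.trans h.symm)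
    rw [classVector_of_not_inputSync hkl, classVector_of_not_inputSync hkm, transport_zero]

namespace PerturbationSetup

variable [Fintype C] [Fintype A] {𝒮 : D.PerturbationSetup} {p : D.State → D.State}
  {u : C(I, D.State) × ℝ} {τ : ℝ}

theorem IsGeneric.rests_upstream (h : 𝒮.IsGeneric p u τ) {e : C} {i : Bool}
    (he : (e, i) ∈ 𝒮.rests p u τ) (a : G.Input e) : (G.tail a.1, i) ∈ 𝒮.rests p u τ := by
  by_contra hn
  exact (h.inputSync_of_moving (Or.inr ⟨a, rfl⟩) hn).1 he

/-- The balance condition for nodes at rest. -/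
theorem IsGeneric.inputSync_of_rest (h : 𝒮.IsGeneric p u τ) {e e' : C} {i j : Bool}
    (he : (e, i) ∈ 𝒮.rests p u τ) (he' : (e', j) ∈ 𝒮.rests p u τ)
    (hs : ((e, i), (e', j)) ∈ 𝒮.syncs u τ) :
    D.InputSync (𝒮.shifted u τ i) (𝒮.shifted u τ j) e e' := by
  classical
  set z := 𝒮.shifted u τ with hz
  set F := 𝒮.f + p with hF
  set U := 𝒮.rests p u τ with hU
  have hFa : D.IsAdmissible F := h.isOrbit.admissible
  have hFd : Differentiable ℝ F := h.isOrbit.smooth.differentiable (by simp)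
  have hclosed : ∀ k ∈ U, ∀ l : C × Bool, D.InputSync (z k.2) (z l.2) k.1 l.1 → l ∈ U :=
    fun k hk l hkl => (hFa.sameState_of_inputSync hkl).eq_zero_iff.1 hk
  let R₁ : C × Bool → C × Bool → Prop := fun k l => (k, l) ∈ 𝒮.syncs u τ
  let R₂ : C × Bool → C × Bool → Prop := fun k l => D.InputSync (z k.2) (z l.2) k.1 l.1
  let sec : Bool → Set C := fun i => {e | (e, i) ∈ U}
  have hle : D.syncSubspace U R₁ ≤ D.syncSubspace U R₂ := fun v hv =>
    ⟨hv.1, fun k hk l hl hR hd => hv.2 k hk l hl (by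
      obtain ⟨β, h1, -⟩ := hR
      exact h1) hd⟩
  let M : (Bool → D.State) →ₗ[ℝ] (Bool → D.State) :=
    LinearMap.pi fun i => ((D.cutoff (sec i)).comp ((fderiv ℝ F (D.cutoff (sec i) (z i))).comp
      (D.cutoff (sec i)))).toLinearMap.comp (LinearMap.proj i)
  have hM : ∀ (v : Bool → D.State) (k : C × Bool), k ∈ U →
      M v k.2 k.1 = fderiv ℝ F (z k.2) (v k.2) k.1 := by
    intro v k hk
    refine (cutoff_of_mem (s := sec k.2) hk _).trans ?_
    exact hFa.fderiv_cutoff hFd (s := sec k.2) hk (fun a => h.rests_upstream hk a) _ _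
  have hM0 : ∀ (v : Bool → D.State) (k : C × Bool), k ∉ U → M v k.2 k.1 = 0 :=
    fun v k hk => cutoff_of_notMem (s := sec k.2) hk _
  have hrange : ∀ k ∈ U, ∀ w, D.classVector z k w ∈ (D.syncSubspace U R₁).map M := by
    intro k hk w
    obtain ⟨q, φ, v, hqφ, hκ, hloc, -⟩ := h.isOrbit.exists_localized τ k.1 k.2 w
    obtain ⟨n, hn⟩ := (eventually_all.2 fun j => hloc (z j)).exists
    obtain ⟨κ, hκ1, hκ2⟩ := hκ n
    obtain ⟨hqa, hqs, hφ0, hφ, hφo⟩ := hqφ n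
    obtain ⟨hv1, hv2⟩ := h.variation hqs hφ0 hφ hφo
    let V : Bool → D.State := fun i => D.cutoff (sec i) (𝒮.shifted (v n) τ i)
    have hV : V ∈ D.syncSubspace U R₁ := by
      refine ⟨fun l hl => cutoff_of_notMem (s := sec l.2) hl _, fun l hl m hm hR hd => ?_⟩
      obtain ⟨_, h1⟩ := (hv1 _ hR).1
      simp only [V]
      rw [cutoff_of_mem (s := sec l.2) hl, cutoff_of_mem (s := sec m.2) hm]
      exact h1
    have hMV : M V = -(κ • D.classVector z k w) := by
      ext1 j
      ext1 b
      rw [Pi.neg_apply, Pi.neg_apply, Pi.smul_apply, Pi.smul_apply]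
      by_cases hb : (b, j) ∈ U
      · have h1 := hv2 (b, j) hb
        have h2 : M V j b = fderiv ℝ F (z j) (𝒮.shifted (v n) τ j) b := by
          rw [← hM (fun i => 𝒮.shifted (v n) τ i) (b, j) hb]
          exact congrArg (fun y => D.cutoff (sec j) (fderiv ℝ F (D.cutoff (sec j) (z j)) y) b)
            (cutoff_cutoff (sec j) (𝒮.shifted (v n) τ j))
        have h3 : q n (z j) b = κ • D.classVector z k w j b := by
          by_cases hkb : D.InputSync (z k.2) (z j) k.1 b
          · obtain ⟨hd, h4⟩ := hqa.sameState_of_inputSync hkb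
            rw [classVector_of_inputSync (l := (b, j)) hkb hd, ← transport_smul, ← hκ2]
            exact h4.symm
          · rw [classVector_of_not_inputSync (l := (b, j)) hkb, smul_zero]
            by_contra hne
            exact hkb (hn j b hne)
        rw [h2, ← h3]
        exact eq_neg_of_add_eq_zero_left h1
      · rw [hM0 V (b, j) hb, classVector_of_not_inputSync (l := (b, j))
          fun h' => hb (hclosed k hk _ h'), smul_zero, neg_zero]
    refine ⟨-κ⁻¹ • V, (D.syncSubspace U R₁).smul_mem _ hV, ?_⟩
    rw [map_smul, hMV, smul_neg, neg_smul, neg_neg, inv_smul_smul₀ (by linarith)]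
  have hsub : D.syncSubspace U R₂ ≤ (D.syncSubspace U R₁).map M :=
    mem_of_classVector_mem hrange hclosed
  have heq : D.syncSubspace U R₁ = D.syncSubspace U R₂ :=
    Submodule.eq_of_le_of_finrank_le hle
      ((Submodule.finrank_mono hsub).trans (Submodule.finrank_map_le M _))
  by_contra hns
  obtain ⟨w, hw⟩ := D.exists_ne_zero e
  have hmem : D.classVector z (e, i) w ∈ D.syncSubspace U R₁ := by
    rw [heq]; exact classVector_mem_syncSubspace hclosed he w
  obtain ⟨hd, -⟩ := id hs
  have h1 := hmem.2 (e, i) he (e', j) he' hs hd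
  rw [classVector_of_inputSync (k := (e, i)) (l := (e, i)) (.refl _ _) rfl,
    classVector_of_not_inputSync (k := (e, i)) (l := (e', j)) hns, transport_rfl] at h1
  exact hw (transport_injective hd (h1.trans (transport_zero hd).symm))

/-- At a generic point, synchronous node states have synchronous inputs. -/
theorem IsGeneric.inputSync (h : 𝒮.IsGeneric p u τ) {e e' : C} {i j : Bool}
    (hs : ((e, i), (e', j)) ∈ 𝒮.syncs u τ) :
    D.InputSync (𝒮.shifted u τ i) (𝒮.shifted u τ j) e e' := by
  by_cases he : (e, i) ∈ 𝒮.rests p u τ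
  · by_cases he' : (e', j) ∈ 𝒮.rests p u τ
    · exact h.inputSync_of_rest he he' hs
    · have hs' : ((e', j), (e, i)) ∈ 𝒮.syncs u τ := SameState.symm hs
      exact ((h.inputSync_of_moving (Or.inl rfl) he').2 e i hs').symm
  · exact (h.inputSync_of_moving (Or.inl rfl) he).2 e' j hs

end PerturbationSetup
end Network.NodeSpaces

namespace Network.NodeSpaces.PerturbationSetup

variable {C A : Type*} {G : Network C A} {D : G.NodeSpaces} [Fintype C] [Fintype A]
  {𝒮 : D.PerturbationSetup} {p : D.State → D.State} {u : C(I, D.State) × ℝ} {τ : ℝ}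

/-- The coincidences at a generic time persist for all times. -/
theorem IsGeneric.syncs_subset (h : 𝒮.IsGeneric p u τ) (t : ℝ) :
    𝒮.syncs u τ ⊆ 𝒮.syncs u t := by
  classical
  set F := 𝒮.f + p with hF
  have hFa : D.IsAdmissible F := h.isOrbit.admissible
  have hFs : ContDiff ℝ ∞ F := h.isOrbit.smooth
  let S : Setoid (C × Bool) :=
    { r := fun k l => (k, l) ∈ 𝒮.syncs u τ
      iseqv := ⟨fun k => SameState.refl _ _, fun h => SameState.symm h,
        fun h h' => SameState.trans h h'⟩ }
  let rep : C × Bool → C × Bool := fun k => (Quotient.mk S k).out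
  have hrep : ∀ k, (rep k, k) ∈ 𝒮.syncs u τ := fun k => Quotient.mk_out (s := S) k
  have hrep_eq : ∀ k l, (k, l) ∈ 𝒮.syncs u τ → rep k = rep l := fun k l hkl => by
    have h1 : Quotient.mk S k = Quotient.mk S l := Quotient.sound hkl
    simp only [rep, h1]
  have hdim : ∀ k, D.dim (rep k).1 = D.dim k.1 := fun k => by
    obtain ⟨hd, -⟩ := hrep k
    exact hd
  let Pr : (Bool → D.State) →L[ℝ] (Bool → D.State) := .pi fun j => .pi fun e =>
    (transportL (hdim (e, j))).toContinuousLinearMap.comp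
      ((ContinuousLinearMap.proj (R := ℝ) (φ := D.P) (rep (e, j)).1).comp
        (ContinuousLinearMap.proj (R := ℝ) (φ := fun _ : Bool => D.State) (rep (e, j)).2))
  have hPr : ∀ y (k : C × Bool), D.SameState (y (rep k).2) (Pr y k.2) (rep k).1 k.1 :=
    fun y k => ⟨hdim k, rfl⟩
  have hsync : ∀ y k l, (k, l) ∈ 𝒮.syncs u τ → D.SameState (Pr y k.2) (Pr y l.2) k.1 l.1 := by
    intro y k l hkl
    have h1 := hPr y k
    rw [hrep_eq k l hkl] at h1
    exact h1.symm.trans (hPr y l)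
  have hfix : ∀ y : Bool → D.State, (∀ k, D.SameState (y (rep k).2) (y k.2) (rep k).1 k.1) →
      Pr y = y := by
    intro y hy
    ext1 j
    ext1 e
    exact (hy (e, j)).2
  let F2 : (Bool → D.State) → (Bool → D.State) := fun y i => F (y i)
  have hF2s : ContDiff ℝ ∞ F2 := contDiff_pi.2 fun i => hFs.comp (contDiff_apply ℝ D.State i)
  have hinv : ∀ y, Pr (F2 (Pr y)) = F2 (Pr y) := by
    intro y
    refine hfix _ fun k => ?_
    obtain ⟨β, h1, h2⟩ := h.inputSync (e := (rep k).1) (e' := k.1) (i := (rep k).2) (j := k.2)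
      (hrep k)
    exact hFa.sameState β (hsync y _ k (hrep k))
      fun a => hsync y (G.tail a.1, (rep k).2) (G.tail (β.toEquiv a).1, k.2) (h2 a)
  let z : ℝ → Bool → D.State := fun t i => 𝒮.shifted u t i
  have hz : ∀ t, HasDerivAt z (u.2 • F2 (z t)) t := fun t =>
    hasDerivAt_pi.2 fun i => hasDerivAt_shifted h.isOrbit t i
  have hzb : ∀ t, ‖z t‖ ≤ ‖u‖ := fun t =>
    (pi_norm_le_iff_of_nonneg (norm_nonneg u)).2 fun i => norm_shifted_le u t i
  let H : (Bool → D.State) → (Bool → D.State) := fun y => u.2 • (F2 y - Pr (F2 y))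
  have hHs : ContDiff ℝ ∞ H := by
    have := Pr.contDiff (n := ∞) |>.comp hF2s
    exact (hF2s.sub this).const_smul u.2
  have hH0 : ∀ y, H (Pr y) = 0 := fun y => by simp only [H, hinv, sub_self, smul_zero]
  set B : ℝ := ‖Pr‖ * ‖u‖ with hB
  have hPz : ∀ t, ‖Pr (z t)‖ ≤ B := fun t =>
    (Pr.le_opNorm _).trans (mul_le_mul_of_nonneg_left (hzb t) (norm_nonneg _))
  set R : ℝ := ‖u‖ + B with hR
  have hB0 : 0 ≤ B := by positivity
  obtain ⟨K, hK⟩ : ∃ K, LipschitzOnWith K H (Metric.closedBall 0 (R + B)) :=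
    (hHs.of_le (by simp) : ContDiff ℝ 1 H).locallyLipschitz.locallyLipschitzOn
      |>.exists_lipschitzOnWith_of_compact (isCompact_closedBall _ _)
  have hw : (fun t => z t - Pr (z t)) = fun _ => 0 := by
    refine ODE_solution_unique_univ (v := fun t y => H (y + Pr (z t))) (K := K)
      (s := fun _ => Metric.closedBall 0 R) (t₀ := τ) (fun t => ?_) (fun t => ⟨?_, ?_⟩)
      (fun t => ⟨?_, ?_⟩) ?_
    · refine LipschitzOnWith.of_dist_le_mul fun y hy y' hy' => ?_
      have hmem : ∀ y ∈ Metric.closedBall (0 : Bool → D.State) R,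
          y + Pr (z t) ∈ Metric.closedBall (0 : Bool → D.State) (R + B) := by
        intro y hy
        rw [mem_closedBall_zero_iff] at hy ⊢
        exact (norm_add_le _ _).trans (add_le_add hy (hPz t))
      have := hK.dist_le_mul _ (hmem y hy) _ (hmem y' hy')
      rwa [dist_add_right] at this
    · have h1 := (hz t).sub (Pr.hasFDerivAt.comp_hasDerivAt t (hz t))
      simp only [sub_add_cancel]
      rw [map_smul, ← smul_sub] at h1
      exact h1
    · rw [mem_closedBall_zero_iff]
      exact (norm_sub_le _ _).trans (add_le_add (hzb t) (hPz t))
    · simp only [zero_add, hH0]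
      exact hasDerivAt_const t 0
    · rw [mem_closedBall_zero_iff, norm_zero]; positivity
    · rw [sub_eq_zero]
      exact (hfix _ hrep).symm
  intro k hk
  have h1 : Pr (z t) = z t := (sub_eq_zero.1 (congrFun hw t)).symm
  have h2 := hsync (z t) k.1 k.2 hk
  rw [h1] at h2
  exact h2

/-- A coincidence at a generic time extends to all inputs and all times. -/
theorem IsGeneric.exists_inputIso (h : 𝒮.IsGeneric p u τ) {c d : C} {i j : Bool}
    (hs : ((c, i), (d, j)) ∈ 𝒮.syncs u τ) :
    ∃ β : G.InputIso c d, ∀ t, D.SameState (𝒮.shifted u t i) (𝒮.shifted u t j) c d ∧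
      ∀ a : G.Input c, D.SameState (𝒮.shifted u t i) (𝒮.shifted u t j)
        (G.tail a.1) (G.tail (β.toEquiv a).1) := by
  obtain ⟨β, -, h2⟩ := h.inputSync hs
  exact ⟨β, fun t => ⟨h.syncs_subset t hs, fun a => h.syncs_subset t
    (show ((G.tail a.1, i), (G.tail (β.toEquiv a).1, j)) ∈ 𝒮.syncs u τ from h2 a)⟩⟩

omit [Fintype A] in
/-- A perturbed orbit in the original time. -/
theorem IsOrbit.isPeriodicOrbit (h : 𝒮.IsOrbit p u) (hne : ∃ s t, profile u.1 s ≠ profile u.1 t)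
    (t₀ : ℝ) : IsPeriodicOrbit (𝒮.f + p) (fun t => profile u.1 ((t - t₀) / u.2)) u.2 where
  period_pos := h.pos
  solution t := by
    have h1 : HasDerivAt (fun t => (t - t₀) / u.2) (1 / u.2) t :=
      ((hasDerivAt_id t).sub_const t₀).div_const u.2
    have h2 := HasDerivAt.scomp (h := fun t => (t - t₀) / u.2) t
      (h.hasDerivAt ((t - t₀) / u.2)) h1
    rwa [smul_smul, one_div, inv_mul_cancel₀ h.pos.ne', one_smul] at h2
  periodic t := by
    have : (t + u.2 - t₀) / u.2 = (t - t₀) / u.2 + 1 := by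
      field_simp [h.pos.ne']; ring
    simp only [this, profile_periodic u.1 _]
  nonconstant := by
    obtain ⟨s, t, hst⟩ := hne
    refine ⟨t₀ + u.2 * s, t₀ + u.2 * t, ?_⟩
    simpa [mul_div_cancel_left₀ _ h.pos.ne'] using hst

end Network.NodeSpaces.PerturbationSetup

theorem isPerturbation_zero {C A : Type*} {G : Network C A} [Fintype C] {D : G.NodeSpaces} {ε : ℝ}
    (hε : 0 < ε) : D.IsPerturbation 0 ε := by
  refine ⟨Network.NodeSpaces.isAdmissible_zero, contDiff_zero_fun, ?_⟩
  have : c1Norm (0 : D.State → D.State) = 0 := by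
    simp [c1Norm]
  rw [this]
  exact ENNReal.ofReal_pos.2 hε

/-- Closeness of rescaled orbits gives closeness on one period. -/
theorem exists_radius_orbitClose {E : Type*} [NormedAddCommGroup E] [NormedSpace ℝ E] {x : ℝ → E}
    (hx : Continuous x) {T : ℝ} (hT : 0 < T) (t₀ : ℝ) (u₀ : C(I, E) × ℝ) (hu₀ : u₀.2 = T)
    (hprof : ∀ τ, profile u₀.1 τ = x (t₀ + T * τ)) {η : ℝ} (hη : 0 < η) :
    ∃ r > 0, ∀ u : C(I, E) × ℝ, ‖u - u₀‖ < r →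
      OrbitClose η x T (fun t => profile u.1 ((t - t₀) / u.2)) u.2 := by
  have h1 : ∀ᶠ S in 𝓝 T, ∀ t ∈ Icc 0 T, ‖x (t₀ + T * ((t - t₀) / S)) - x t‖ < η / 2 := by
    refine isCompact_Icc.eventually_forall_of_forall_eventually fun t _ => ?_
    have h2 : ContinuousAt (fun z : ℝ × ℝ => ‖x (t₀ + T * ((z.2 - t₀) / z.1)) - x z.2‖) (T, t) := by
      have h3 : ContinuousAt (fun z : ℝ × ℝ => t₀ + T * ((z.2 - t₀) / z.1)) (T, t) :=
        continuousAt_const.add (continuousAt_const.mul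
          ((continuousAt_snd.sub continuousAt_const).div continuousAt_fst hT.ne'))
      exact ((hx.continuousAt.comp h3).sub (hx.continuousAt.comp continuousAt_snd)).norm
    refine h2.eventually_lt_const ?_
    have : t₀ + T * ((t - t₀) / T) = t := by field_simp; ring
    simp only [this, sub_self, norm_zero]
    positivity
  obtain ⟨r, hr, hball⟩ := Metric.eventually_nhds_iff.1 h1
  refine ⟨min r (η / 2), by positivity, fun u hu => ⟨?_, fun t ht => ?_⟩⟩
  · have h2 := (norm_snd_le (u - u₀)).trans_lt (hu.trans_le (min_le_right _ _))
    rw [Prod.snd_sub, hu₀, Real.norm_eq_abs] at h2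
    linarith
  · have h2 := (norm_snd_le (u - u₀)).trans_lt (hu.trans_le (min_le_left _ _))
    rw [Prod.snd_sub, hu₀, ← dist_eq_norm] at h2
    have h3 := hball h2 t ht
    have h4 := (norm_profile_sub_le u.1 u₀.1 ((t - t₀) / u.2)).trans_lt
      ((norm_fst_le (u - u₀)).trans_lt (hu.trans_le (min_le_right _ _)))
    rw [hprof] at h4
    have h5 := norm_sub_le_norm_sub_add_norm_sub (profile u.1 ((t - t₀) / u.2))
      (x (t₀ + T * ((t - t₀) / u.2))) (x t)
    linarith

open Network Network.NodeSpaces PerturbationSetup in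
theorem theorem11p1 {C A : Type*} [Fintype C] [Fintype A] (G : Network C A) (D : G.NodeSpaces)
    (f : D.State → D.State) (hf : D.IsAdmissible f) (hf_smooth : ContDiff ℝ ∞ f)
    (x : ℝ → D.State) (T : ℝ) (hx : D.IsStronglyHyperbolic f x T)
    (t₀ : ℝ) (ℓ : D.State →L[ℝ] ℝ) (hℓ : ℓ (f (x t₀)) ≠ 0)
    (c d : C) (θ : ℝ) (J : Set ℝ) (hJ : J.OrdConnected) (hJ_int : (interior J).Nonempty)
    (hphase : D.RigidlyPhaseRelated f x T t₀ ℓ c d θ J) :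
    Nonempty (G.InputIso c d) ∧
    ∀ τ : G.InputIso c d, ∃ β : G.InputIso d d, ∀ t ∈ J,
      D.SameState (x t) (x (t + θ * T)) c d ∧
      ∀ a : G.Input c, D.SameState (x t) (x (t + θ * T))
        (G.tail a.1) (G.tail (β.toEquiv (τ.toEquiv a)).1) := by
  obtain ⟨hT, hsol, hper, hne⟩ := hx.hyperbolic.1
  have hxc : Continuous x := continuous_iff_continuousAt.2 fun t => (hsol t).continuousAt
  let g : C(D.State, D.State) := ⟨f, hf_smooth.continuous⟩
  let u₀ : C(I, D.State) × ℝ := ((⟨fun τ : I => x (t₀ + T * τ), by fun_prop⟩ : C(I, D.State)), T)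
  have hnd : IsNondegenerateZero ℓ (ℓ (x t₀)) g u₀ :=
    IsHyperbolicOrbit.isNondegenerateZero (f := g)
      (hf_smooth.of_le (by exact_mod_cast le_top)) hx.hyperbolic hxc t₀ ℓ hℓ
  have hprof : ∀ τ, profile u₀.1 τ = x (t₀ + T * τ) := by
    intro τ
    have h1 : Function.Periodic (fun τ => x (t₀ + T * τ)) 1 := fun τ => by
      simp only [mul_add, mul_one, ← add_assoc, hper]
    have h2 := h1.int_mul ⌊τ⌋ (Int.fract τ)
    rw [mul_one, Int.fract_add_floor] at h2
    exact h2.symm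
  obtain ⟨η, hη, ε, hε, hrigid⟩ := hphase
  obtain ⟨r₁, hr₁, hclose⟩ := exists_radius_orbitClose hxc hT t₀ u₀ rfl hprof hη
  obtain ⟨t₁, t₂, ht₁₂⟩ := hne
  have hgap : 0 < ‖x t₁ - x t₂‖ := norm_pos_iff.2 (sub_ne_zero.2 ht₁₂)
  have hnonconst : ∀ u : C(I, D.State) × ℝ, ‖u - u₀‖ < ‖x t₁ - x t₂‖ / 2 →
      ∃ s t, profile u.1 s ≠ profile u.1 t := by
    intro u hu
    by_contra! hcon
    have key : ∀ t, x t = profile u₀.1 ((t - t₀) / T) := fun t => by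
      rw [hprof]; congr 1; field_simp; ring
    have hb : ∀ t, ‖profile u.1 ((t - t₀) / T) - x t‖ < ‖x t₁ - x t₂‖ / 2 := fun t => by
      rw [key t]
      exact (norm_profile_sub_le _ _ _).trans_lt ((norm_fst_le (u - u₀)).trans_lt hu)
    have h1 := norm_sub_le_norm_sub_add_norm_sub (x t₁) (profile u.1 ((t₁ - t₀) / T)) (x t₂)
    have h2 := hb t₁
    have h3 := hb t₂
    rw [norm_sub_rev] at h2
    rw [hcon _ ((t₁ - t₀) / T)] at h3
    linarith
  obtain ⟨s₀, hs₀⟩ := hJ_int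
  let Good : G.InputIso c d → Set (C(I, D.State) × ℝ) := fun β =>
    {u | ∀ t, D.SameState (profile u.1 t) (profile u.1 (t + θ)) c d ∧
      ∀ a : G.Input c, D.SameState (profile u.1 t) (profile u.1 (t + θ))
        (G.tail a.1) (G.tail (β.toEquiv a).1)}
  have hcontP : ∀ t, Continuous fun u : C(I, D.State) × ℝ => profile u.1 t := fun t =>
    (continuous_eval_const _).comp continuous_fst
  have hclosed : ∀ β, IsClosed (Good β) := fun β => by
    simp only [Good, ofPred_forall, ofPred_and]
    exact isClosed_iInter fun t => (isClosed_sameState (hcontP t) (hcontP _) _ _).inter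
      (isClosed_iInter fun a => isClosed_sameState (hcontP t) (hcontP _) _ _)
  have happrox : ∀ r > 0, ∃ u : C(I, D.State) × ℝ, ‖u - u₀‖ < r ∧ ∃ β, u ∈ Good β := by
    intro r hr
    let 𝒮 : D.PerturbationSetup :=
      { f := f, admissible := hf, smooth := hf_smooth, functional := ℓ, level := ℓ (x t₀)
        size := ε, base := u₀, radius := min r (min r₁ (‖x t₁ - x t₂‖ / 2)), phase := θ
        start := t₀, times := interior J, isOpen_times := isOpen_interior }
    have horb : 𝒮.IsOrbit 0 u₀ :=
      ⟨isPerturbation_zero hε, ⟨g, by simp [g, 𝒮], hnd⟩,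
        by simpa [𝒮] using ⟨hr, hr₁, sub_ne_zero.2 ht₁₂⟩, hT⟩
    obtain ⟨p, u, τ, hgen⟩ := exists_isGeneric (τ := (s₀ - t₀) / T) horb (by
      have : t₀ + T * ((s₀ - t₀) / T) = s₀ := by field_simp; ring
      simpa [𝒮, u₀, this] using hs₀)
    have hor := hgen.isOrbit
    have hu := hor.close
    have hmem : ((c, false), (d, true)) ∈ 𝒮.syncs u τ := by
      have h1 := hor.isPeriodicOrbit (hnonconst u (hu.trans_le
        ((min_le_right _ _).trans (min_le_right _ _)))) t₀
      have h2 := hclose u (hu.trans_le ((min_le_right _ _).trans (min_le_left _ _)))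
      have h3 : ℓ (profile u.1 0) = ℓ (x t₀) := by
        obtain ⟨g', -, hz⟩ := hor.zero
        have := (periodMap_eq_zero_iff.1 hz.zero).2
        simpa [profile] using this
      have h4 := hrigid p hor.perturbation _ _ h1 h2 (by simpa using h3) _
        (interior_subset hgen.mem_times)
      have e1 : (t₀ + u.2 * τ - t₀) / u.2 = τ := by
        have := hor.pos.ne'
        field_simp; ring
      have e2 : (t₀ + u.2 * τ + θ * u.2 - t₀) / u.2 = τ + θ := by
        have := hor.pos.ne'
        field_simp; ring
      simp only [𝒮, e1, e2] at h4
      simpa [syncs, shifted, 𝒮] using h4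
    obtain ⟨β, hβ⟩ := hgen.exists_inputIso hmem
    refine ⟨u, hu.trans_le (min_le_left _ _), β, fun t => ?_⟩
    simpa [shifted, 𝒮] using hβ t
  obtain ⟨β₀, hβ₀⟩ : ∃ β, u₀ ∈ Good β := by
    by_contra! hcon
    have h1 : ∀ᶠ u in 𝓝 u₀, ∀ β, u ∉ Good β :=
      eventually_all.2 fun β => (hclosed β).isOpen_compl.mem_nhds (hcon β)
    obtain ⟨r, hr, hball⟩ := Metric.eventually_nhds_iff.1 h1
    obtain ⟨u, hu, β, hβ⟩ := happrox r hr
    exact hball (by rwa [dist_eq_norm]) β hβ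
  refine ⟨⟨β₀⟩, fun τ => ⟨τ.symm.trans β₀, fun t _ => ?_⟩⟩
  have h1 := hβ₀ ((t - t₀) / T)
  have e1 : t₀ + T * ((t - t₀) / T) = t := by field_simp; ring
  have e2 : t₀ + T * ((t - t₀) / T + θ) = t + θ * T := by field_simp; ring
  rw [hprof, hprof, e1, e2] at h1
  simpa [InputIso.trans, InputIso.symm] using h1
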